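/- **Setting.** Let $\Psi$ be the cumulative distribution function of a probability measure on $(0,1]$. Start with finitely many intervals whose lengths are positive and sum to $1$. Let $\Pi$ be a Poisson random measure on $[0,\infty)\times[0,1]^2$ with intensity $e^t\,dt\otimes d\Psi(u)\otimes dv$. For $t\ge 0$ let $\widetilde A_{t-}(x)=\sum_i I_i\mathbf 1\{I_i\le x\}$, where $I_1,I_2,\dots$ are the interval lengths just before time $t$, and let $\ell_t(u)=\widetilde A_{t-}^{-1}(u)=\inf\{x:\widetilde A_{t-}(x)\ge u\}$. At each point $(t,u,v)$ of $\Pi$ an interval of length $\ell_t(u)$ is replaced by two intervals of lengths $v\,\ell_t(u)$ and $(1-v)\,\ell_t(u)$. Let $L_t=\max_{u\in(0,1)}\ell_t(u)$ be the length of the largest interval. **Lemma 5.2.** Assume that the absolutely continuous part of $\Psi$ has a density $\psi$ such that, for some $c>0$ and $\kappa\ge 1$, $\psi(u)\ge c\,\kappa\,(1-u)^{\kappa-1}$ for almost every $u<1$ in a neighborhood of $1$. Then for every $\alpha<1/\kappa$, $$\mathbb P\big(\exists\,T:\ L_t\le e^{-\alpha t}\ \ \forall\, t\ge T\big)=1 .$$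 The exponent $1/\kappa$ is optimal: if in addition $1-\Psi(u)\le C(1-u)^{\kappa}$ for some constant $C$ and all $u<1$ close enough to $1$ (as for $\Psi(u)=1-(1-u)^\kappa$), then for every $\alpha>1/\kappa$, $$\mathbb P\big(\exists\,T:\ L_t> e^{-\alpha t}\ \ \forall\, t\ge T\big)=1 .$$ -/

import Mathlib

open MeasureTheory ProbabilityTheory Set Filter Topology
open scoped ENNReal NNReal

noncomputable section

namespace IntervalSplitting

/-- `N` is a Poisson random measure with intensity `μ`: it is a measurable random measure, the
mass of a measurable set `A` is Poisson with parameter `μ A` (almost surely infinite if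
`μ A = ∞`), and the masses of finitely many pairwise disjoint measurable sets are independent. -/
structure IsPoissonRandomMeasure {Ω E : Type*} [MeasurableSpace Ω] [MeasurableSpace E]
    (N : Ω → Measure E) (μ : Measure E) (P : Measure Ω) : Prop where
  measurable : Measurable N
  law_of_finite : ∀ A : Set E, MeasurableSet A → μ A ≠ ∞ →
    P.map (fun ω => N ω A) = (poissonMeasure (μ A).toNNReal).map (fun k : ℕ => (k : ℝ≥0∞))
  law_of_infinite : ∀ A : Set E, MeasurableSet A → μ A = ∞ → ∀ᵐ ω ∂P, N ω A = ∞
  indep : ∀ (n : ℕ) (A : Fin n → Set E), (∀ i, MeasurableSet (A i)) →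
    Pairwise (fun i j => Disjoint (A i) (A j)) → iIndepFun (fun i ω => N ω (A i)) P

/-- The intensity `e^t dt ⊗ dΨ(u) ⊗ dv` on `[0,∞) × [0,1] × [0,1]` (as a measure on `ℝ × ℝ × ℝ`
that vanishes off this set), where `ν` is the law on `(0,1]` with distribution function `Ψ`. -/
def intensity (ν : Measure ℝ) : Measure (ℝ × ℝ × ℝ) :=
  ((volume.restrict (Ici (0 : ℝ))).withDensity (fun t => ENNReal.ofReal (Real.exp t))).prod
    (ν.prod (volume.restrict (Icc (0 : ℝ) 1)))

/-- The size-biased empirical distribution function `x ↦ ∑ᵢ Iᵢ 1{Iᵢ ≤ x}` of a finite multiset of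
interval lengths. -/
def sizeBiasedCDF (I : Multiset ℝ) (x : ℝ) : ℝ :=
  (I.filter (fun a => a ≤ x)).sum

/-- The generalized inverse at `u` of the size-biased empirical distribution function. For
`u ∈ (0,1]` and lengths of total `1` it is one of the lengths. -/
def quantile (I : Multiset ℝ) (u : ℝ) : ℝ :=
  sInf {x : ℝ | u ≤ sizeBiasedCDF I x}

/-- One step: an interval of length `ℓ = quantile I u` is divided into two intervals of lengths
`v ℓ` and `(1 - v) ℓ`. -/
def split (I : Multiset ℝ) (u v : ℝ) : Multiset ℝ :=
  (v * quantile I u) ::ₘ ((1 - v) * quantile I u) ::ₘ I.erase (quantile I u)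

/-- The interval lengths after the first `n` of the points `p 0, p 1, …` have been used, where
`p k = (s, u, v)` causes a split with marks `u` and `v` (at time `s`). -/
def lengthsAfter (I₀ : Multiset ℝ) (p : ℕ → ℝ × ℝ × ℝ) : ℕ → Multiset ℝ
  | 0 => I₀
  | n + 1 => split (lengthsAfter I₀ p n) (p n).2.1 (p n).2.2

/-- The number of points strictly before time `t`. -/
def countBefore (p : ℕ → ℝ × ℝ × ℝ) (t : ℝ) : ℕ :=
  {n : ℕ | (p n).1 < t}.ncard

/-- The interval lengths just before time `t` (the state at time `t-`) of the process driven by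
points `p 0, p 1, …` listed in increasing order of time. -/
def lengthsBefore (I₀ : Multiset ℝ) (p : ℕ → ℝ × ℝ × ℝ) (t : ℝ) : Multiset ℝ :=
  lengthsAfter I₀ p (countBefore p t)

/-- `L_t = max_{u ∈ (0,1)} ℓ_t(u)`, where `ℓ_t` is the generalized inverse of the size-biased
empirical distribution function at time `t-`: the length of the largest interval. -/
def largest (I₀ : Multiset ℝ) (p : ℕ → ℝ × ℝ × ℝ) (t : ℝ) : ℝ :=
  sSup (quantile (lengthsBefore I₀ p t) '' Ioo 0 1)

end IntervalSplitting

end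

/-!
The splitting process only depends on time through the number of points that have arrived, so it is
the discrete chain `Config.chain` driven by the successive marks, read at the counting process of
the points.

*Upper bound.* The marks are independent with law `markLaw ν = Ψ ⊗ U[0,1]` (`map_mark_eq`,
`iIndepFun_mark`). The energy of level `x` of a configuration is the sum of the squares of the
lengths that are at least `x`. A split of a length `a ≥ x` lowers the energy on average by at least
`a² / 3` (`Config.integral_energy_step_le`), so the mean loss is governed by the integral over `Ψ`
of `sqAbove x`, that is `a² 1{a ≥ x}`, along the quantile function. Over the uniform law on `(0,1)`
the integral of the same function is the sum of the cubes `a³`, which is at least `x` times the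
energy. As quantiles increase with `u`, and are constant on the top stretch of width at least `x` as
soon as some length is at least `x`, that integral is at most a constant times the one over
`(1 - δ, 1 - x/2)`, where the density of `Ψ` is at least of the order `x ^ (κ - 1)`. So for small
`x` the energy contracts in mean by a factor `1 - K x ^ κ` in each step
(`Config.le_lintegral_sqAbove`, `integral_energy_chain_le`), whatever the configuration
is. With `x = exp (-β m)`, `β < 1/κ`, and the order of `exp m` steps,
Markov's inequality gives a doubly exponentially small probability that a length of at least `x` is
left at time `m`, and the Borel-Cantelli lemma applies (`ae_eventually_lengthsAfter_lt`). A Chernoff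
bound for the Poisson law shows that enough points have arrived (`ae_eventually_lt_countBefore`).

*Lower bound.* As long as no mark falls into `(1 - 2x, 1]`, a length of at least `x` survives
(`IsConfig.exists_mem_split_ge`): a length of at least `2x` leaves a piece of at least `x`, and the
last length in `[x, 2x)` could only be split by a mark in this stretch. The expected number of
points before time `m` with a mark in the stretch is at most of the order `exp m * x ^ κ`, which for
`x = exp (-β m)`, `β > 1/κ`, is summable (`ae_eventually_lt_largest`).

*Independence of the marks.* It is deduced from the independence of the masses of disjoint sets by
means of a time grid. In a grid of mesh `h`, the event that the first points lie in distinct cells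
and have marks in given sets can be written in terms of the masses of cells times sets of marks, by
recursion over the cells (`gridEvent`), which makes its probability a product
(`measure_gridEvent_eq`). As `h → 0` the points lie in distinct cells with probability tending to
`1` (`measure_marks_eq`).
-/

noncomputable section

namespace IntervalSplitting

/-! ### Configurations of interval lengths and the quantile function -/

/-- A configuration of interval lengths: nonnegative numbers of total `1`. Lengths equal to `0` are
allowed because a split with `v = 0` or `v = 1` produces them. -/
def IsConfig (I : Multiset ℝ) : Prop :=
  (∀ a ∈ I, 0 ≤ a) ∧ I.sum = 1

theorem sizeBiasedCDF_cons (a : ℝ) (I : Multiset ℝ) (x : ℝ) :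
    sizeBiasedCDF (a ::ₘ I) x = (if a ≤ x then a else 0) + sizeBiasedCDF I x := by
  unfold sizeBiasedCDF
  by_cases h : a ≤ x <;> simp [h]

theorem sizeBiasedCDF_eq_sum_map (I : Multiset ℝ) (x : ℝ) :
    sizeBiasedCDF I x = (I.map fun a => if a ≤ x then a else 0).sum := by
  induction I using Multiset.induction_on with
  | empty => simp [sizeBiasedCDF]
  | cons a I ih => simp [sizeBiasedCDF_cons, ih]

theorem sizeBiasedCDF_mono {I : Multiset ℝ} (hI : ∀ a ∈ I, 0 ≤ a) :
    Monotone (sizeBiasedCDF I) := by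
  intro x y hxy
  rw [sizeBiasedCDF_eq_sum_map, sizeBiasedCDF_eq_sum_map]
  refine Multiset.sum_map_le_sum_map _ _ fun a ha => ?_
  have := hI a ha
  split_ifs <;> linarith

theorem sizeBiasedCDF_nonneg {I : Multiset ℝ} (hI : ∀ a ∈ I, 0 ≤ a) (x : ℝ) :
    0 ≤ sizeBiasedCDF I x :=
  Multiset.sum_nonneg fun a ha => hI a (Multiset.mem_of_mem_filter ha)

theorem sizeBiasedCDF_eq_sum {I : Multiset ℝ} {x : ℝ} (h : ∀ a ∈ I, a ≤ x) :
    sizeBiasedCDF I x = I.sum := by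
  rw [sizeBiasedCDF, Multiset.filter_eq_self.2 h]

theorem IsConfig.sizeBiasedCDF_le_one {I : Multiset ℝ} (hI : IsConfig I) (x : ℝ) :
    sizeBiasedCDF I x ≤ 1 := by
  rw [← hI.2, ← Multiset.filter_add_not (fun a => a ≤ x) I, Multiset.sum_add,
    Multiset.filter_add_not]
  have : 0 ≤ (I.filter fun a => ¬ a ≤ x).sum :=
    Multiset.sum_nonneg fun a ha => hI.1 a (Multiset.mem_of_mem_filter ha)
  unfold sizeBiasedCDF
  linarith

theorem IsConfig.le_one {I : Multiset ℝ} (hI : IsConfig I) {a : ℝ} (ha : a ∈ I) : a ≤ 1 :=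
  hI.2 ▸ Multiset.single_le_sum hI.1 a ha

theorem IsConfig.exists_max {I : Multiset ℝ} (hI : IsConfig I) :
    ∃ M ∈ I, ∀ a ∈ I, a ≤ M := by
  have hne : I.toFinset.Nonempty := by
    rw [Multiset.toFinset_nonempty]
    rintro rfl
    simpa using hI.2
  obtain ⟨M, hM, hmax⟩ := I.toFinset.exists_max_image id hne
  exact ⟨M, Multiset.mem_toFinset.1 hM, fun a ha => hmax a (Multiset.mem_toFinset.2 ha)⟩

/-- The superlevel sets of the size-biased distribution function are closed half-lines that start
at one of the lengths: it is a right-continuous step function. -/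
theorem IsConfig.exists_mem_le_sizeBiasedCDF_iff {I : Multiset ℝ} (hI : IsConfig I) {u : ℝ}
    (hu : u ∈ Ioc (0 : ℝ) 1) : ∃ q ∈ I, ∀ x, u ≤ sizeBiasedCDF I x ↔ q ≤ x := by
  classical
  obtain ⟨M, hM, hmax⟩ := hI.exists_max
  have hne : (I.toFinset.filter fun a => u ≤ sizeBiasedCDF I a).Nonempty := by
    refine ⟨M, Finset.mem_filter.2 ⟨Multiset.mem_toFinset.2 hM, ?_⟩⟩
    rw [sizeBiasedCDF_eq_sum hmax, hI.2]
    exact hu.2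
  obtain ⟨q, hq, hmin⟩ := Finset.exists_min_image _ id hne
  rw [Finset.mem_filter, Multiset.mem_toFinset] at hq
  refine ⟨q, hq.1, fun x => ⟨fun hx => ?_, fun hx => hq.2.trans (sizeBiasedCDF_mono hI.1 hx)⟩⟩
  have hne' : (I.toFinset.filter fun a => a ≤ x).Nonempty := by
    by_contra hcon
    rw [Finset.not_nonempty_iff_eq_empty, Finset.filter_eq_empty_iff] at hcon
    have : sizeBiasedCDF I x = 0 := by
      rw [sizeBiasedCDF, Multiset.filter_eq_nil.2 fun a ha => hcon (Multiset.mem_toFinset.2 ha),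
        Multiset.sum_zero]
    linarith [hu.1]
  obtain ⟨a, ha, hamax⟩ := Finset.exists_max_image _ id hne'
  rw [Finset.mem_filter, Multiset.mem_toFinset] at ha
  have heq : sizeBiasedCDF I a = sizeBiasedCDF I x := by
    unfold sizeBiasedCDF
    congr 1
    refine Multiset.filter_congr fun b hb => ⟨fun h => h.trans ha.2, fun h => ?_⟩
    exact hamax b (Finset.mem_filter.2 ⟨Multiset.mem_toFinset.2 hb, h⟩)
  exact (hmin a (Finset.mem_filter.2 ⟨Multiset.mem_toFinset.2 ha.1, heq ▸ hx⟩)).trans ha.2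

theorem IsConfig.quantile_spec {I : Multiset ℝ} (hI : IsConfig I) {u : ℝ}
    (hu : u ∈ Ioc (0 : ℝ) 1) :
    quantile I u ∈ I ∧ ∀ x, u ≤ sizeBiasedCDF I x ↔ quantile I u ≤ x := by
  obtain ⟨q, hq, h⟩ := hI.exists_mem_le_sizeBiasedCDF_iff hu
  have : quantile I u = q := by
    have hset : {x : ℝ | u ≤ sizeBiasedCDF I x} = Ici q := by
      ext x
      exact h x
    rw [quantile, hset, csInf_Ici]
  rw [this]
  exact ⟨hq, h⟩

theorem IsConfig.quantile_mem {I : Multiset ℝ} (hI : IsConfig I) {u : ℝ}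
    (hu : u ∈ Ioc (0 : ℝ) 1) : quantile I u ∈ I :=
  (hI.quantile_spec hu).1

theorem IsConfig.quantile_le_iff {I : Multiset ℝ} (hI : IsConfig I) {u : ℝ}
    (hu : u ∈ Ioc (0 : ℝ) 1) {x : ℝ} : quantile I u ≤ x ↔ u ≤ sizeBiasedCDF I x :=
  ((hI.quantile_spec hu).2 x).symm

theorem IsConfig.quantile_mono {I : Multiset ℝ} (hI : IsConfig I) {u u' : ℝ}
    (hu : u ∈ Ioc (0 : ℝ) 1) (hu' : u' ∈ Ioc (0 : ℝ) 1) (h : u ≤ u') :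
    quantile I u ≤ quantile I u' :=
  (hI.quantile_le_iff hu).2 (h.trans ((hI.quantile_le_iff hu').1 le_rfl))

theorem IsConfig.sizeBiasedCDF_le_of_lt {I : Multiset ℝ} (hI : IsConfig I) {a y : ℝ}
    (ha : a ∈ I) (hy : y < a) : sizeBiasedCDF I y ≤ 1 - a := by
  have h := hI.2
  rw [← Multiset.cons_erase ha, Multiset.sum_cons] at h
  have hcdf : sizeBiasedCDF I y = sizeBiasedCDF (I.erase a) y := by
    conv_lhs => rw [← Multiset.cons_erase ha]
    rw [sizeBiasedCDF_cons, if_neg (not_le.2 hy), zero_add]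
  have hle : sizeBiasedCDF (I.erase a) y ≤ (I.erase a).sum := by
    rw [sizeBiasedCDF_eq_sum_map]
    conv_rhs => rw [← Multiset.map_id' (I.erase a)]
    refine Multiset.sum_map_le_sum_map _ _ fun b hb => ?_
    have := hI.1 b (Multiset.mem_of_mem_erase hb)
    split_ifs
    · exact le_rfl
    · exact this
  linarith

/-- The top stretch of quantiles, of width at least `a` for every length `a` present, belongs to
lengths that are at least `a`. -/
theorem IsConfig.le_quantile {I : Multiset ℝ} (hI : IsConfig I) {u a : ℝ}
    (hu : u ∈ Ioc (0 : ℝ) 1) (ha : a ∈ I) (hau : 1 - a < u) : a ≤ quantile I u := by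
  by_contra! hcon
  have h1 := (hI.quantile_le_iff hu).1 le_rfl
  have h2 := hI.sizeBiasedCDF_le_of_lt ha hcon
  linarith

theorem sum_map_split {I : Multiset ℝ} {u v : ℝ} (hq : quantile I u ∈ I) (f : ℝ → ℝ) :
    ((split I u v).map f).sum = (I.map f).sum - f (quantile I u) + f (v * quantile I u)
      + f ((1 - v) * quantile I u) := by
  have h : (I.map f).sum = f (quantile I u) + ((I.erase (quantile I u)).map f).sum := by
    conv_lhs => rw [← Multiset.cons_erase hq]
    simp
  rw [h]
  simp only [split, Multiset.map_cons, Multiset.sum_cons]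
  ring

theorem IsConfig.split {I : Multiset ℝ} (hI : IsConfig I) {u v : ℝ} (hu : u ∈ Ioc (0 : ℝ) 1)
    (hv : v ∈ Icc (0 : ℝ) 1) : IsConfig (split I u v) := by
  have hq := hI.quantile_mem hu
  constructor
  · intro a ha
    simp only [IntervalSplitting.split, Multiset.mem_cons] at ha
    rcases ha with rfl | rfl | ha
    · exact mul_nonneg hv.1 (hI.1 _ hq)
    · exact mul_nonneg (sub_nonneg.2 hv.2) (hI.1 _ hq)
    · exact hI.1 a (Multiset.mem_of_mem_erase ha)
  · have h := sum_map_split (v := v) hq id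
    simp only [id, Multiset.map_id'] at h
    rw [h, hI.2]
    ring

theorem IsConfig.forall_mem_split_le {I : Multiset ℝ} (hI : IsConfig I) {u v b : ℝ}
    (hu : u ∈ Ioc (0 : ℝ) 1) (hv : v ∈ Icc (0 : ℝ) 1) (hb : ∀ a ∈ I, a ≤ b) :
    ∀ a ∈ IntervalSplitting.split I u v, a ≤ b := by
  have hq := hI.quantile_mem hu
  have hq0 := hI.1 _ hq
  have hqb := hb _ hq
  intro a ha
  simp only [IntervalSplitting.split, Multiset.mem_cons] at ha
  rcases ha with rfl | rfl | ha
  · exact (mul_le_of_le_one_left hq0 hv.2).trans hqb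
  · exact (mul_le_of_le_one_left hq0 (by linarith [hv.1])).trans hqb
  · exact hb a (Multiset.mem_of_mem_erase ha)

/-- A length of at least `x` survives every split whose mark `u` avoids the top stretch
`(1 - 2x, 1]`: a length `≥ 2x` that is split leaves a piece `≥ x`, and if the only length `≥ x` is
smaller than `2x`, then it occupies a subinterval of the top stretch. -/
theorem IsConfig.exists_mem_split_ge {I : Multiset ℝ} (hI : IsConfig I) {u v x : ℝ}
    (hu : u ∈ Ioc (0 : ℝ) 1) (hux : u ≤ 1 - 2 * x) (h : ∃ a ∈ I, x ≤ a) :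
    ∃ a ∈ IntervalSplitting.split I u v, x ≤ a := by
  have hq := hI.quantile_mem hu
  set q := quantile I u with hqdef
  simp only [IntervalSplitting.split, Multiset.mem_cons, ← hqdef]
  by_cases hrest : ∃ a ∈ I.erase q, x ≤ a
  · obtain ⟨a, ha, hxa⟩ := hrest
    exact ⟨a, Or.inr (Or.inr ha), hxa⟩
  push Not at hrest
  have hxq : x ≤ q := by
    obtain ⟨a, ha, hxa⟩ := h
    rw [← Multiset.cons_erase hq, Multiset.mem_cons] at ha
    rcases ha with rfl | ha
    · exact hxa
    · exact absurd hxa (not_le.2 (hrest a ha))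
  by_cases h2 : 2 * x ≤ q
  · rcases le_total (1 / 2) v with hv | hv
    · exact ⟨v * q, Or.inl rfl, by nlinarith [hI.1 _ hq]⟩
    · exact ⟨(1 - v) * q, Or.inr (Or.inl rfl), by nlinarith [hI.1 _ hq]⟩
  · exfalso
    push Not at h2
    have hsum : (I.erase q).sum = 1 - q := by
      have := hI.2
      rw [← Multiset.cons_erase hq, Multiset.sum_cons] at this
      linarith
    -- All other lengths are smaller than `q`, so some level `y < q` carries the mass `1 - q`.
    obtain ⟨y, hyq, hy⟩ : ∃ y < q, ∀ a ∈ I.erase q, a ≤ y := by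
      by_cases hne : (I.erase q).toFinset.Nonempty
      · obtain ⟨y, hy, hmax⟩ := (I.erase q).toFinset.exists_max_image id hne
        exact ⟨y, (hrest y (Multiset.mem_toFinset.1 hy)).trans_le hxq,
          fun a ha => hmax a (Multiset.mem_toFinset.2 ha)⟩
      · refine ⟨q - 1, by linarith, fun a ha => ?_⟩
        exact absurd ⟨a, Multiset.mem_toFinset.2 ha⟩ hne
    have hcdf : sizeBiasedCDF I y = 1 - q := by
      rw [← Multiset.cons_erase hq, sizeBiasedCDF_cons, if_neg (not_le.2 hyq), zero_add,
        sizeBiasedCDF_eq_sum hy, hsum]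
    have := (hI.quantile_le_iff hu).2 (show u ≤ sizeBiasedCDF I y by rw [hcdf]; linarith)
    exact absurd this (not_le.2 hyq)

theorem IsConfig.sSup_quantile_le {I : Multiset ℝ} (hI : IsConfig I) {b : ℝ}
    (hb : ∀ a ∈ I, a ≤ b) : sSup (quantile I '' Ioo 0 1) ≤ b := by
  refine csSup_le ⟨_, mem_image_of_mem _ (show (1 / 2 : ℝ) ∈ Ioo (0 : ℝ) 1 by norm_num)⟩ ?_
  rintro _ ⟨u, hu, rfl⟩
  exact hb _ (hI.quantile_mem ⟨hu.1, hu.2.le⟩)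

theorem IsConfig.le_sSup_quantile {I : Multiset ℝ} (hI : IsConfig I) {a : ℝ}
    (ha : a ∈ I) (ha0 : 0 < a) : a ≤ sSup (quantile I '' Ioo 0 1) := by
  have ha1 := hI.le_one ha
  have hu : 1 - a / 2 ∈ Ioo (0 : ℝ) 1 := ⟨by linarith, by linarith⟩
  refine le_csSup_of_le ⟨1, ?_⟩ (mem_image_of_mem _ hu)
    (hI.le_quantile ⟨hu.1, hu.2.le⟩ ha (by linarith))
  rintro _ ⟨u, hu, rfl⟩
  exact hI.le_one (hI.quantile_mem ⟨hu.1, hu.2.le⟩)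

/-- The marks `(u, v)` for which a split makes sense. -/
def markSet : Set (ℝ × ℝ) := Ioc (0 : ℝ) 1 ×ˢ Icc (0 : ℝ) 1

theorem measurableSet_markSet : MeasurableSet markSet :=
  measurableSet_Ioc.prod measurableSet_Icc

section Trajectory

variable {I₀ : Multiset ℝ} {p : ℕ → ℝ × ℝ × ℝ}

theorem IsConfig.lengthsAfter (hI : IsConfig I₀) (hp : ∀ n, (p n).2 ∈ markSet) (n : ℕ) :
    IsConfig (lengthsAfter I₀ p n) := by
  induction n with
  | zero => exact hI
  | succ n ih => exact ih.split (hp n).1 (hp n).2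

theorem IsConfig.forall_mem_lengthsAfter_le (hI : IsConfig I₀) (hp : ∀ n, (p n).2 ∈ markSet)
    {b : ℝ} {m n : ℕ} (hmn : m ≤ n) (hb : ∀ a ∈ IntervalSplitting.lengthsAfter I₀ p m, a ≤ b) :
    ∀ a ∈ IntervalSplitting.lengthsAfter I₀ p n, a ≤ b := by
  induction n, hmn using Nat.le_induction with
  | base => exact hb
  | succ n _ ih => exact (hI.lengthsAfter hp n).forall_mem_split_le (hp n).1 (hp n).2 ih

theorem IsConfig.exists_mem_lengthsAfter_ge (hI : IsConfig I₀) (hp : ∀ n, (p n).2 ∈ markSet)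
    {x : ℝ} {n : ℕ} (hux : ∀ k < n, (p k).2.1 ≤ 1 - 2 * x) (h : ∃ a ∈ I₀, x ≤ a) :
    ∃ a ∈ IntervalSplitting.lengthsAfter I₀ p n, x ≤ a := by
  induction n with
  | zero => exact h
  | succ n ih =>
    exact (hI.lengthsAfter hp n).exists_mem_split_ge (hp n).1 (hux n n.lt_succ_self)
      (ih fun k hk => hux k (hk.trans n.lt_succ_self))

end Trajectory

/-! ### The embedded chain and its energy -/

/-- The state space of the embedded chain. -/
structure Config where
  /-- The interval lengths. -/
  lengths : Multiset ℝ
  isConfig : IsConfig lengths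

/-- The `σ`-algebra on configurations generated by the additive functionals `I ↦ ∑ₐ f a`. -/
instance : MeasurableSpace Config :=
  ⨆ f : {f : ℝ → ℝ // Measurable f},
    MeasurableSpace.comap (fun I : Config => (I.1.map f.1).sum) inferInstance

theorem Config.measurable_sum_map {f : ℝ → ℝ} (hf : Measurable f) :
    Measurable fun I : Config => (I.1.map f).sum :=
  Measurable.of_comap_le (le_iSup (fun f : {f : ℝ → ℝ // Measurable f} =>
    MeasurableSpace.comap (fun I : Config => (I.1.map f.1).sum) inferInstance) ⟨f, hf⟩)

theorem Config.measurable_of_sum_map {X : Type*} [MeasurableSpace X] {g : X → Config}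
    (h : ∀ f : ℝ → ℝ, Measurable f → Measurable fun x => ((g x).1.map f).sum) :
    Measurable g := by
  rw [measurable_iff_comap_le]
  refine MeasurableSpace.comap_le_iff_le_map.2 (iSup_le fun f => ?_)
  rw [← MeasurableSpace.comap_le_iff_le_map, MeasurableSpace.comap_comp]
  exact (h f.1 f.2).comap_le

open Classical in
/-- The quantile function of a configuration, set to `0` off `(0,1]`. -/
def Config.quantile (I : Config) (u : ℝ) : ℝ :=
  if u ∈ Ioc (0 : ℝ) 1 then IntervalSplitting.quantile I.1 u else 0

theorem Config.quantile_of_mem (I : Config) {u : ℝ} (hu : u ∈ Ioc (0 : ℝ) 1) :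
    I.quantile u = IntervalSplitting.quantile I.1 u := if_pos hu

theorem Config.measurable_sizeBiasedCDF (x : ℝ) :
    Measurable fun I : Config => sizeBiasedCDF I.1 x := by
  simp_rw [sizeBiasedCDF_eq_sum_map]
  exact Config.measurable_sum_map (Measurable.ite measurableSet_Iic measurable_id measurable_const)

theorem Config.measurable_quantile :
    Measurable fun z : Config × ℝ => z.1.quantile z.2 := by
  refine measurable_of_Iic fun x => ?_
  have hset : (fun z : Config × ℝ => z.1.quantile z.2) ⁻¹' Iic x
      = ({z | z.2 ∈ Ioc (0 : ℝ) 1} ∩ {z | z.2 ≤ sizeBiasedCDF z.1.1 x})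
        ∪ ({z | z.2 ∈ Ioc (0 : ℝ) 1}ᶜ ∩ {_z | 0 ≤ x}) := by
    ext z
    by_cases hz : z.2 ∈ Ioc (0 : ℝ) 1
    · rw [mem_preimage, mem_Iic, z.1.quantile_of_mem hz, z.1.2.quantile_le_iff hz]
      simp [hz.1, hz.2]
    · have h0 : z.1.quantile z.2 = 0 := if_neg hz
      simp only [mem_preimage, mem_Iic, h0, mem_union, mem_inter_iff, mem_ofPred_eq, hz,
        false_and, mem_compl_iff, not_false_eq_true, true_and, false_or]
  have h1 : MeasurableSet {z : Config × ℝ | z.2 ∈ Ioc (0 : ℝ) 1} :=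
    measurable_snd measurableSet_Ioc
  rw [hset]
  exact (h1.inter (measurableSet_le measurable_snd
    ((Config.measurable_sizeBiasedCDF x).comp measurable_fst))).union
      (h1.compl.inter (MeasurableSet.const _))

theorem Config.measurable_quantile_right (I : Config) : Measurable I.quantile :=
  Config.measurable_quantile.comp (measurable_const.prodMk measurable_id)

open Classical in
/-- One step of the embedded chain; marks off `markSet` leave the configuration unchanged. -/
def Config.step (I : Config) (z : ℝ × ℝ) : Config :=
  if h : z ∈ markSet then ⟨split I.1 z.1 z.2, I.2.split h.1 h.2⟩ else I

theorem Config.step_of_mem (I : Config) {z : ℝ × ℝ} (hz : z ∈ markSet) :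
    (I.step z).1 = split I.1 z.1 z.2 := by
  rw [Config.step, dif_pos hz]

theorem Config.sum_map_step (I : Config) {z : ℝ × ℝ} (hz : z ∈ markSet) (f : ℝ → ℝ) :
    ((I.step z).1.map f).sum = (I.1.map f).sum - f (I.quantile z.1) + f (z.2 * I.quantile z.1)
      + f ((1 - z.2) * I.quantile z.1) := by
  rw [I.step_of_mem hz, sum_map_split (I.2.quantile_mem hz.1), I.quantile_of_mem hz.1]

theorem Config.measurable_step : Measurable fun y : Config × (ℝ × ℝ) => y.1.step y.2 := by
  classical
  refine Config.measurable_of_sum_map fun f hf => ?_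
  have hset : MeasurableSet {y : Config × (ℝ × ℝ) | y.2 ∈ markSet} :=
    measurable_snd measurableSet_markSet
  have hq : Measurable fun y : Config × (ℝ × ℝ) => y.1.quantile y.2.1 :=
    Config.measurable_quantile.comp
      (measurable_fst.prodMk (measurable_fst.comp measurable_snd))
  have hv : Measurable fun y : Config × (ℝ × ℝ) => y.2.2 := measurable_snd.comp measurable_snd
  have hs : Measurable fun y : Config × (ℝ × ℝ) => (y.1.1.map f).sum :=
    (Config.measurable_sum_map hf).comp measurable_fst
  have heq : (fun y : Config × (ℝ × ℝ) => ((y.1.step y.2).1.map f).sum)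
      = fun y => if y ∈ {y : Config × (ℝ × ℝ) | y.2 ∈ markSet} then
        (y.1.1.map f).sum - f (y.1.quantile y.2.1) + f (y.2.2 * y.1.quantile y.2.1)
          + f ((1 - y.2.2) * y.1.quantile y.2.1) else (y.1.1.map f).sum := by
    funext y
    by_cases hy : y.2 ∈ markSet
    · rw [if_pos (show y ∈ {y : Config × (ℝ × ℝ) | y.2 ∈ markSet} from hy),
        Config.sum_map_step _ hy]
    · rw [if_neg (show y ∉ {y : Config × (ℝ × ℝ) | y.2 ∈ markSet} from hy), Config.step,
        dif_neg hy]
  rw [heq]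
  exact Measurable.ite hset (((hs.sub (hf.comp hq)).add (hf.comp (hv.mul hq))).add
    (hf.comp ((measurable_const.sub hv).mul hq))) hs

/-- The embedded chain driven by a sequence of marks. -/
def Config.chain (I : Config) (z : ℕ → ℝ × ℝ) : ℕ → Config
  | 0 => I
  | n + 1 => (Config.chain I z n).step (z n)

theorem Config.chain_eq_lengthsAfter (I : Config) {p : ℕ → ℝ × ℝ × ℝ}
    (hp : ∀ n, (p n).2 ∈ markSet) (n : ℕ) :
    (I.chain (fun k => (p k).2) n).1 = lengthsAfter I.1 p n := by
  induction n with
  | zero => rfl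
  | succ n ih =>
    change ((I.chain (fun k => (p k).2) n).step (p n).2).1 = _
    rw [Config.step_of_mem _ (hp n), ih]
    rfl

/-- The function `a ↦ a² 1{x ≤ a}`. -/
def sqAbove (x a : ℝ) : ℝ := if x ≤ a then a ^ 2 else 0

theorem measurable_sqAbove (x : ℝ) : Measurable (sqAbove x) :=
  Measurable.ite measurableSet_Ici (measurable_id.pow_const 2) measurable_const

theorem sqAbove_nonneg (x a : ℝ) : 0 ≤ sqAbove x a := by
  unfold sqAbove
  split_ifs <;> positivity

theorem sqAbove_le_self {x a : ℝ} (h0 : 0 ≤ a) (h1 : a ≤ 1) : sqAbove x a ≤ a := by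
  unfold sqAbove
  split_ifs
  · nlinarith
  · exact h0

theorem sqAbove_mono {x a b : ℝ} (ha : 0 ≤ a) (hab : a ≤ b) : sqAbove x a ≤ sqAbove x b := by
  unfold sqAbove
  split_ifs
  · gcongr
  · linarith
  · positivity
  · exact le_rfl

theorem sqAbove_mul_le {x v a : ℝ} (hv : v ∈ Icc (0 : ℝ) 1) (ha : 0 ≤ a) :
    sqAbove x (v * a) ≤ v ^ 2 * sqAbove x a := by
  have hva : v * a ≤ a := mul_le_of_le_one_left ha hv.2
  by_cases h : x ≤ v * a
  · rw [sqAbove, if_pos h, sqAbove, if_pos (h.trans hva), mul_pow]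
  · rw [sqAbove, if_neg h]
    exact mul_nonneg (sq_nonneg v) (sqAbove_nonneg x a)

/-- The sum of the squares of the lengths that are at least `x`. -/
def Config.energy (x : ℝ) (I : Config) : ℝ := (I.1.map (sqAbove x)).sum

theorem Config.measurable_energy (x : ℝ) : Measurable (Config.energy x) :=
  Config.measurable_sum_map (measurable_sqAbove x)

theorem Config.energy_nonneg (x : ℝ) (I : Config) : 0 ≤ I.energy x := by
  refine Multiset.sum_nonneg fun b hb => ?_
  obtain ⟨a, -, rfl⟩ := Multiset.mem_map.1 hb
  exact sqAbove_nonneg x a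

theorem Config.energy_le_one (x : ℝ) (I : Config) : I.energy x ≤ 1 := by
  rw [← I.2.2]
  conv_rhs => rw [← Multiset.map_id' I.1]
  exact Multiset.sum_map_le_sum_map _ _ fun a ha =>
    sqAbove_le_self (I.2.1 a ha) (I.2.le_one ha)

theorem Config.sq_le_energy {x : ℝ} (hx : 0 ≤ x) (I : Config) (h : ∃ a ∈ I.1, x ≤ a) :
    x ^ 2 ≤ I.energy x := by
  obtain ⟨a, ha, hxa⟩ := h
  calc x ^ 2 ≤ sqAbove x a := by rw [sqAbove, if_pos hxa]; gcongr
    _ ≤ I.energy x := by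
        refine Multiset.single_le_sum (fun b hb => ?_) _ (Multiset.mem_map_of_mem _ ha)
        obtain ⟨a, -, rfl⟩ := Multiset.mem_map.1 hb
        exact sqAbove_nonneg x a

theorem Config.quantile_mem_Icc (I : Config) (u : ℝ) : I.quantile u ∈ Icc (0 : ℝ) 1 := by
  by_cases hu : u ∈ Ioc (0 : ℝ) 1
  · rw [I.quantile_of_mem hu]
    exact ⟨I.2.1 _ (I.2.quantile_mem hu), I.2.le_one (I.2.quantile_mem hu)⟩
  · rw [Config.quantile, if_neg hu]
    simp

theorem Config.energy_step_le (x : ℝ) (I : Config) {z : ℝ × ℝ} (hz : z ∈ markSet) :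
    (I.step z).energy x
      ≤ I.energy x - sqAbove x (I.quantile z.1) * (2 * (z.2 * (1 - z.2))) := by
  unfold Config.energy
  rw [I.sum_map_step hz]
  have hq := (I.quantile_mem_Icc z.1).1
  have h1 := sqAbove_mul_le (x := x) hz.2 hq
  have h2 := sqAbove_mul_le (x := x) (v := 1 - z.2)
    ⟨by linarith [hz.2.2], by linarith [hz.2.1]⟩ hq
  linarith

/-- The quantile function of a configuration at a uniform argument has the size-biased law. -/
theorem Config.map_quantile (I : Config) :
    (volume.restrict (Ioc (0 : ℝ) 1)).map I.quantile
      = (I.1.map fun a => ENNReal.ofReal a • Measure.dirac a).sum := by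
  refine Measure.ext_of_Iic _ _ fun x => ?_
  rw [Measure.map_apply I.measurable_quantile_right measurableSet_Iic,
    Measure.restrict_apply (I.measurable_quantile_right measurableSet_Iic)]
  have hset : I.quantile ⁻¹' Iic x ∩ Ioc 0 1 = Ioc 0 (sizeBiasedCDF I.1 x) := by
    ext u
    constructor
    · rintro ⟨h, hu⟩
      rw [mem_preimage, mem_Iic, I.quantile_of_mem hu, I.2.quantile_le_iff hu] at h
      exact ⟨hu.1, h⟩
    · rintro ⟨h0, h⟩
      have hu : u ∈ Ioc (0 : ℝ) 1 := ⟨h0, h.trans (I.2.sizeBiasedCDF_le_one x)⟩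
      refine ⟨?_, hu⟩
      rw [mem_preimage, mem_Iic, I.quantile_of_mem hu, I.2.quantile_le_iff hu]
      exact h
  rw [hset, Real.volume_Ioc, sub_zero]
  have key : ∀ J : Multiset ℝ, (∀ a ∈ J, 0 ≤ a) → ENNReal.ofReal (sizeBiasedCDF J x)
      = (J.map fun a => ENNReal.ofReal a • Measure.dirac a).sum (Iic x) := by
    intro J
    induction J using Multiset.induction_on with
    | empty => simp [sizeBiasedCDF]
    | cons a J ih =>
      intro hJ
      have ha := hJ a (Multiset.mem_cons_self a J)
      have hJ' : ∀ b ∈ J, 0 ≤ b := fun b hb => hJ b (Multiset.mem_cons_of_mem hb)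
      rw [sizeBiasedCDF_cons, Multiset.map_cons, Multiset.sum_cons, Measure.add_apply, ← ih hJ',
        ENNReal.ofReal_add (by split_ifs <;> simp [ha]) (sizeBiasedCDF_nonneg hJ' x)]
      congr 1
      rw [Measure.smul_apply, Measure.dirac_apply' _ measurableSet_Iic]
      by_cases h : a ≤ x <;> simp [h]
  exact key I.1 I.2.1

theorem Config.lintegral_quantile (I : Config) {g : ℝ → ℝ≥0∞} (hg : Measurable g) :
    ∫⁻ u in Ioc (0 : ℝ) 1, g (I.quantile u)
      = (I.1.map fun a => ENNReal.ofReal a * g a).sum := by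
  rw [← lintegral_map hg I.measurable_quantile_right, I.map_quantile]
  induction I.1 using Multiset.induction_on with
  | empty => simp
  | cons a J ih => simp [lintegral_add_measure, lintegral_dirac' _ hg, ih]

/-- The size-biased mean of `sqAbove x` dominates `x` times the energy. -/
theorem Config.ofReal_mul_energy_le_lintegral (I : Config) {x : ℝ} (hx : 0 < x) :
    ENNReal.ofReal (x * I.energy x)
      ≤ ∫⁻ u in Ioo (0 : ℝ) 1, ENNReal.ofReal (sqAbove x (I.quantile u)) := by
  rw [Measure.restrict_congr_set Ioo_ae_eq_Ioc,
    I.lintegral_quantile (measurable_sqAbove x).ennreal_ofReal, Config.energy]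
  have key : ∀ J : Multiset ℝ, ENNReal.ofReal (x * (J.map (sqAbove x)).sum)
      ≤ (J.map fun a => ENNReal.ofReal a * ENNReal.ofReal (sqAbove x a)).sum := by
    intro J
    induction J using Multiset.induction_on with
    | empty => simp
    | cons a J ih =>
      rw [Multiset.map_cons, Multiset.sum_cons, Multiset.map_cons, Multiset.sum_cons, mul_add]
      refine ENNReal.ofReal_add_le.trans (add_le_add ?_ ih)
      by_cases h : x ≤ a
      · rw [← ENNReal.ofReal_mul (hx.le.trans h)]
        exact ENNReal.ofReal_le_ofReal (mul_le_mul_of_nonneg_right h (sqAbove_nonneg x a))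
      · simp [sqAbove, h]
  exact key I.1

/-- Moving the argument `u` into the stretch `(1 - δ, 1 - x/2)` by an affine map does not decrease
`sqAbove x` of the quantile: an argument that moves down was within `x` of `1` and remains so, and
there the quantile takes its largest value, unless all lengths are smaller than `x`. -/
theorem Config.sqAbove_quantile_le (I : Config) {x δ u : ℝ} (hx : 0 < x) (hxδ : x ≤ δ)
    (hδ : δ ≤ 1 / 2) (hu : u ∈ Ioo (0 : ℝ) 1) :
    sqAbove x (I.quantile u) ≤ sqAbove x (I.quantile ((δ - x / 2) * u + (1 - δ))) := by
  have hu' : u ∈ Ioc (0 : ℝ) 1 := ⟨hu.1, hu.2.le⟩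
  set w := (δ - x / 2) * u + (1 - δ) with hw
  have hwm : w ∈ Ioc (0 : ℝ) 1 := by
    constructor
    · nlinarith [hu.1]
    · nlinarith [hu.2]
  by_cases hq : x ≤ I.quantile u
  · refine sqAbove_mono (I.quantile_mem_Icc u).1 ?_
    rw [I.quantile_of_mem hu'] at hq ⊢
    rw [I.quantile_of_mem hwm]
    rcases le_or_gt u w with h | h
    · exact I.2.quantile_mono hu' hwm h
    · have h1 : 1 - x < u := by nlinarith [hu.2]
      refine I.2.le_quantile hwm (I.2.quantile_mem hu') ?_
      nlinarith [hu.2]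
  · rw [sqAbove, if_neg hq]
    exact sqAbove_nonneg _ _

/-- The probability that an interval is picked, weighted by `sqAbove x` of its length, is at least
of the order `x ^ κ` times the energy. -/
theorem Config.le_lintegral_sqAbove (I : Config) {ν : Measure ℝ} {κ c δ x : ℝ} (hκ : 1 ≤ κ)
    (hc : 0 < c) (hδ : δ ≤ 1 / 2)
    (hψ : ∀ᵐ u ∂(volume : Measure ℝ), u ∈ Ioo (1 - δ) 1 →
      ENNReal.ofReal (c * κ * (1 - u) ^ (κ - 1)) ≤ ν.rnDeriv volume u)
    (hx : 0 < x) (hxδ : x ≤ δ) :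
    ENNReal.ofReal (c * κ * δ * (x / 2) ^ κ * I.energy x)
      ≤ ∫⁻ u, ENNReal.ofReal (sqAbove x (I.quantile u)) ∂ν := by
  set G : ℝ → ℝ≥0∞ := fun u => ENNReal.ofReal (sqAbove x (I.quantile u)) with hG
  have hGm : Measurable G :=
    ((measurable_sqAbove x).comp I.measurable_quantile_right).ennreal_ofReal
  set φ : ℝ → ℝ := fun u => (δ - x / 2) * u + (1 - δ) with hφ
  have ha : 0 < δ - x / 2 := by linarith
  have himage : φ '' Ioo 0 1 ⊆ Ioo (1 - δ) (1 - x / 2) := by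
    rintro _ ⟨u, hu, rfl⟩
    constructor
    · simp only [hφ]; nlinarith [hu.1]
    · simp only [hφ]; nlinarith [hu.2]
  have hinj : InjOn φ (Ioo 0 1) := by
    intro u _ u' _ h
    simp only [hφ] at h
    exact mul_left_cancel₀ ha.ne' (by linarith)
  have hderiv : ∀ u ∈ Ioo (0 : ℝ) 1, HasDerivWithinAt φ (δ - x / 2) (Ioo 0 1) u := by
    intro u _
    have := (((hasDerivAt_id u).const_mul (δ - x / 2)).add_const (1 - δ)).hasDerivWithinAt
      (s := Ioo (0 : ℝ) 1)
    simpa [hφ] using this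
  have hchange := lintegral_image_eq_lintegral_abs_deriv_mul measurableSet_Ioo hderiv hinj G
  have hstep1 : ENNReal.ofReal (δ - x / 2) * ∫⁻ u in Ioo (0 : ℝ) 1, G u
      ≤ ∫⁻ u in Ioo (1 - δ) (1 - x / 2), G u := by
    calc ENNReal.ofReal (δ - x / 2) * ∫⁻ u in Ioo (0 : ℝ) 1, G u
        = ∫⁻ u in Ioo (0 : ℝ) 1, ENNReal.ofReal |δ - x / 2| * G u := by
          rw [lintegral_const_mul _ hGm, abs_of_pos ha]
      _ ≤ ∫⁻ u in Ioo (0 : ℝ) 1, ENNReal.ofReal |δ - x / 2| * G (φ u) := by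
          refine setLIntegral_mono' measurableSet_Ioo fun u hu => ?_
          exact mul_le_mul_right (ENNReal.ofReal_le_ofReal
            (I.sqAbove_quantile_le hx hxδ hδ hu)) _
      _ = ∫⁻ u in φ '' Ioo 0 1, G u := hchange.symm
      _ ≤ _ := lintegral_mono_set himage
  have hstep2 : ENNReal.ofReal (c * κ * (x / 2) ^ (κ - 1)) * ∫⁻ u in Ioo (1 - δ) (1 - x / 2), G u
      ≤ ∫⁻ u, G u ∂ν := by
    calc ENNReal.ofReal (c * κ * (x / 2) ^ (κ - 1)) * ∫⁻ u in Ioo (1 - δ) (1 - x / 2), G u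
        = ∫⁻ u in Ioo (1 - δ) (1 - x / 2),
            ENNReal.ofReal (c * κ * (x / 2) ^ (κ - 1)) * G u := (lintegral_const_mul _ hGm).symm
      _ ≤ ∫⁻ u in Ioo (1 - δ) (1 - x / 2), ν.rnDeriv volume u * G u := by
          refine lintegral_mono_ae ?_
          filter_upwards [ae_restrict_mem measurableSet_Ioo, ae_restrict_of_ae hψ] with u hu hd
          refine mul_le_mul_left (le_trans (ENNReal.ofReal_le_ofReal ?_)
            (hd ⟨hu.1, by linarith [hu.2]⟩)) _
          exact mul_le_mul_of_nonneg_left (Real.rpow_le_rpow (by positivity)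
            (by linarith [hu.2]) (by linarith)) (by positivity)
      _ ≤ ∫⁻ u, ν.rnDeriv volume u * G u := setLIntegral_le_lintegral _ _
      _ = ∫⁻ u, G u ∂(volume.withDensity (ν.rnDeriv volume)) := by
          rw [lintegral_withDensity_eq_lintegral_mul _ (Measure.measurable_rnDeriv _ _) hGm]
          rfl
      _ ≤ ∫⁻ u, G u ∂ν := lintegral_mono' (Measure.withDensity_rnDeriv_le _ _) le_rfl
  have hpow : (x / 2) ^ κ = (x / 2) ^ (κ - 1) * (x / 2) := by
    rw [Real.rpow_sub_one (by positivity), div_mul_cancel₀ _ (by positivity)]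
  calc ENNReal.ofReal (c * κ * δ * (x / 2) ^ κ * I.energy x)
      ≤ ENNReal.ofReal (c * κ * (x / 2) ^ (κ - 1) * ((δ - x / 2) * (x * I.energy x))) := by
        refine ENNReal.ofReal_le_ofReal ?_
        have h0 : 0 ≤ c * κ * (x / 2) ^ (κ - 1) * x * I.energy x := by
          have := I.energy_nonneg x
          positivity
        rw [hpow]
        nlinarith
    _ = ENNReal.ofReal (c * κ * (x / 2) ^ (κ - 1)) *
          (ENNReal.ofReal (δ - x / 2) * ENNReal.ofReal (x * I.energy x)) := by
        rw [ENNReal.ofReal_mul (by positivity), ENNReal.ofReal_mul ha.le]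
    _ ≤ ENNReal.ofReal (c * κ * (x / 2) ^ (κ - 1)) *
          (ENNReal.ofReal (δ - x / 2) * ∫⁻ u in Ioo (0 : ℝ) 1, G u) := by
        gcongr
        exact I.ofReal_mul_energy_le_lintegral hx
    _ ≤ ENNReal.ofReal (c * κ * (x / 2) ^ (κ - 1)) * ∫⁻ u in Ioo (1 - δ) (1 - x / 2), G u := by
        gcongr
    _ ≤ _ := hstep2

/-! ### Exponential decay of the energy for independent marks -/

theorem measurable_energy_step (x : ℝ) :
    Measurable fun y : Config × (ℝ × ℝ) => (y.1.step y.2).energy x :=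
  (Config.measurable_energy x).comp Config.measurable_step

theorem integrable_of_measurable_of_mem_Icc {X : Type*} [MeasurableSpace X] {μ : Measure X}
    [IsFiniteMeasure μ] {g : X → ℝ} (hg : Measurable g) (h : ∀ y, g y ∈ Icc (0 : ℝ) 1) :
    Integrable g μ :=
  Integrable.of_bound hg.aestronglyMeasurable 1 <| ae_of_all _ fun y => by
    rw [Real.norm_eq_abs, abs_of_nonneg (h y).1]
    exact (h y).2

/-- The law of a pair of marks. -/
def markLaw (ν : Measure ℝ) : Measure (ℝ × ℝ) := ν.prod (volume.restrict (Icc (0 : ℝ) 1))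

instance : IsProbabilityMeasure (volume.restrict (Icc (0 : ℝ) 1)) :=
  ⟨by simp⟩

instance (ν : Measure ℝ) [IsProbabilityMeasure ν] : IsProbabilityMeasure (markLaw ν) := by
  unfold markLaw
  infer_instance

theorem ae_mem_markSet {ν : Measure ℝ} [IsProbabilityMeasure ν] (hν : ν (Ioc 0 1)ᶜ = 0) :
    ∀ᵐ z ∂(markLaw ν), z ∈ markSet := by
  have h1 : ∀ᵐ z ∂(markLaw ν), z.1 ∈ Ioc (0 : ℝ) 1 :=
    Measure.quasiMeasurePreserving_fst.ae (mem_ae_iff.2 hν)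
  have h2 : ∀ᵐ z ∂(markLaw ν), z.2 ∈ Icc (0 : ℝ) 1 :=
    Measure.quasiMeasurePreserving_snd.ae (ae_restrict_mem measurableSet_Icc)
  filter_upwards [h1, h2] with z hz1 hz2 using ⟨hz1, hz2⟩

theorem integral_two_mul_mul_one_sub :
    ∫ v in Icc (0 : ℝ) 1, 2 * (v * (1 - v)) = 1 / 3 := by
  rw [integral_Icc_eq_integral_Ioc, ← intervalIntegral.integral_of_le zero_le_one]
  have h : ∀ v ∈ uIcc (0 : ℝ) 1, HasDerivAt (fun v : ℝ => v ^ 2 - 2 / 3 * v ^ 3)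
      (2 * (v * (1 - v))) v := by
    intro v _
    have := ((hasDerivAt_id v).pow 2).sub (((hasDerivAt_id v).pow 3).const_mul (2 / 3))
    refine this.congr_deriv ?_
    simp
    ring
  rw [intervalIntegral.integral_eq_sub_of_hasDerivAt h
    (Continuous.intervalIntegrable (by fun_prop) _ _)]
  norm_num

/-- One step contracts the energy in mean: a picked interval of length `a` loses on average a third
of its `a²`. -/
theorem Config.integral_energy_step_le (I : Config) {ν : Measure ℝ} [IsProbabilityMeasure ν]
    (hν : ν (Ioc 0 1)ᶜ = 0) {x r : ℝ}
    (hpick : ENNReal.ofReal (r * I.energy x)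
      ≤ ∫⁻ u, ENNReal.ofReal (sqAbove x (I.quantile u)) ∂ν) :
    ∫ z, (I.step z).energy x ∂(markLaw ν) ≤ (1 - r / 3) * I.energy x := by
  have hsq : ∀ u, sqAbove x (I.quantile u) ∈ Icc (0 : ℝ) 1 := fun u =>
    ⟨sqAbove_nonneg _ _, (sqAbove_le_self (I.quantile_mem_Icc u).1 (I.quantile_mem_Icc u).2).trans
      (I.quantile_mem_Icc u).2⟩
  have hsqm : Measurable fun u => sqAbove x (I.quantile u) :=
    (measurable_sqAbove x).comp I.measurable_quantile_right
  have hsqi : Integrable (fun u => sqAbove x (I.quantile u)) ν :=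
    integrable_of_measurable_of_mem_Icc hsqm hsq
  have hvi : Integrable (fun v : ℝ => 2 * (v * (1 - v))) (volume.restrict (Icc (0 : ℝ) 1)) :=
    (Continuous.continuousOn (by fun_prop)).integrableOn_compact isCompact_Icc
  have hpick' : r * I.energy x ≤ ∫ u, sqAbove x (I.quantile u) ∂ν := by
    rw [integral_eq_lintegral_of_nonneg_ae (ae_of_all _ fun u => (hsq u).1)
      hsqm.aestronglyMeasurable]
    rw [← ofReal_integral_eq_lintegral_ofReal hsqi (ae_of_all _ fun u => (hsq u).1)] at hpick ⊢
    rw [ENNReal.toReal_ofReal (integral_nonneg fun u => (hsq u).1)]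
    exact (ENNReal.ofReal_le_ofReal_iff (integral_nonneg fun u => (hsq u).1)).1 hpick
  have hprod : Integrable (fun z : ℝ × ℝ => sqAbove x (I.quantile z.1) * (2 * (z.2 * (1 - z.2))))
      (markLaw ν) := hsqi.mul_prod hvi
  calc ∫ z, (I.step z).energy x ∂(markLaw ν)
      ≤ ∫ z, (I.energy x - sqAbove x (I.quantile z.1) * (2 * (z.2 * (1 - z.2))))
          ∂(markLaw ν) := by
        refine integral_mono_ae ?_ ((integrable_const _).sub hprod) ?_
        · exact integrable_of_measurable_of_mem_Icc
            ((measurable_energy_step x).comp (measurable_const.prodMk measurable_id))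
            fun z => ⟨Config.energy_nonneg _ _, Config.energy_le_one _ _⟩
        · filter_upwards [ae_mem_markSet hν] with z hz using I.energy_step_le x hz
    _ = I.energy x - (∫ u, sqAbove x (I.quantile u) ∂ν) * (1 / 3) := by
        rw [integral_sub (integrable_const _) hprod, integral_const, markLaw,
          integral_prod_mul (fun u => sqAbove x (I.quantile u)) (fun v : ℝ => 2 * (v * (1 - v))),
          integral_two_mul_mul_one_sub]
        simp
    _ ≤ (1 - r / 3) * I.energy x := by linarith

theorem measurable_chain_past {Ω : Type*} {M : ℕ → Ω → ℝ × ℝ} (I : Config) (n : ℕ) :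
    Measurable[⨆ k ∈ Iio n, MeasurableSpace.comap (M k) inferInstance]
      fun ω => I.chain (fun k => M k ω) n := by
  induction n with
  | zero => exact measurable_const
  | succ n ih =>
    refine Config.measurable_step.comp (Measurable.prodMk (ih.mono ?_ le_rfl) ?_)
    · exact biSup_mono fun k hk => lt_trans hk n.lt_succ_self
    · refine Measurable.of_comap_le ?_
      exact le_iSup₂ (f := fun k (_ : k ∈ Iio (n + 1)) =>
        MeasurableSpace.comap (M k) inferInstance) n n.lt_succ_self

section Chain

variable {Ω : Type*} [MeasurableSpace Ω] {P : Measure Ω} {M : ℕ → Ω → ℝ × ℝ}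

theorem measurable_chain (hM : ∀ n, Measurable (M n)) (I : Config) (n : ℕ) :
    Measurable fun ω => I.chain (fun k => M k ω) n :=
  (measurable_chain_past I n).mono (iSup₂_le fun k _ => (hM k).comap_le) le_rfl

theorem indepFun_chain (hM : ∀ n, Measurable (M n)) (hind : iIndepFun M P) (I : Config) (n : ℕ) :
    IndepFun (fun ω => I.chain (fun k => M k ω) n) (M n) P := by
  have h := indep_iSup_of_disjoint (fun k => (hM k).comap_le) hind
    (S := Iio n) (T := {n}) (by simp)
  rw [IndepFun_iff_Indep]
  refine indep_of_indep_of_le_left (indep_of_indep_of_le_right h ?_)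
    (measurable_chain_past I n).comap_le
  simp

/-- Geometric decay of the mean energy of the embedded chain. -/
theorem integral_energy_chain_le [IsProbabilityMeasure P] {ν : Measure ℝ} [IsProbabilityMeasure ν]
    (hν : ν (Ioc 0 1)ᶜ = 0) (hM : ∀ n, Measurable (M n)) (hind : iIndepFun M P)
    (hlaw : ∀ n, P.map (M n) = markLaw ν) {x r : ℝ} (hr3 : r ≤ 3)
    (hpick : ∀ I : Config, ENNReal.ofReal (r * I.energy x)
      ≤ ∫⁻ u, ENNReal.ofReal (sqAbove x (I.quantile u)) ∂ν) (I : Config) (n : ℕ) :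
    ∫ ω, (I.chain (fun k => M k ω) n).energy x ∂P ≤ (1 - r / 3) ^ n := by
  induction n with
  | zero => simpa [Config.chain] using I.energy_le_one x
  | succ n ih =>
    have hJ := measurable_chain hM I n
    have hmap := (indepFun_iff_map_prod_eq_prod_map_map hJ.aemeasurable (hM n).aemeasurable).1
      (indepFun_chain hM hind I n)
    have hprob : IsProbabilityMeasure (P.map fun ω => I.chain (fun k => M k ω) n) :=
      Measure.isProbabilityMeasure_map hJ.aemeasurable
    have hbd : ∀ y : Config × (ℝ × ℝ), (y.1.step y.2).energy x ∈ Icc (0 : ℝ) 1 := fun y =>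
      ⟨Config.energy_nonneg _ _, Config.energy_le_one _ _⟩
    calc ∫ ω, (I.chain (fun k => M k ω) (n + 1)).energy x ∂P
        = ∫ y, (y.1.step y.2).energy x
            ∂(P.map fun ω => (I.chain (fun k => M k ω) n, M n ω)) := by
          rw [integral_map (hJ.prodMk (hM n)).aemeasurable
            (measurable_energy_step x).aestronglyMeasurable]
          rfl
      _ = ∫ J, ∫ z, (J.step z).energy x ∂(markLaw ν)
            ∂(P.map fun ω => I.chain (fun k => M k ω) n) := by
          rw [hmap, hlaw, integral_prod _
            (integrable_of_measurable_of_mem_Icc (measurable_energy_step x) hbd)]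
      _ ≤ ∫ J, (1 - r / 3) * J.energy x ∂(P.map fun ω => I.chain (fun k => M k ω) n) := by
          refine integral_mono ?_ ?_ fun J => J.integral_energy_step_le hν (hpick J)
          · exact (integrable_of_measurable_of_mem_Icc (μ := (P.map _).prod (markLaw ν))
              (measurable_energy_step x) hbd).integral_prod_left
          · exact (integrable_of_measurable_of_mem_Icc (Config.measurable_energy x) fun J =>
              ⟨J.energy_nonneg x, J.energy_le_one x⟩).const_mul _
      _ = (1 - r / 3) * ∫ ω, (I.chain (fun k => M k ω) n).energy x ∂P := by
          rw [integral_const_mul, integral_map hJ.aemeasurable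
            (Config.measurable_energy x).aestronglyMeasurable]
      _ ≤ (1 - r / 3) ^ (n + 1) := by
          rw [pow_succ']
          exact mul_le_mul_of_nonneg_left ih (by linarith)

/-- An exponential bound for the probability that an interval of length at least `x` is left after
`n` steps. -/
theorem measure_exists_chain_ge_le [IsProbabilityMeasure P] {ν : Measure ℝ}
    [IsProbabilityMeasure ν] (hν : ν (Ioc 0 1)ᶜ = 0) (hM : ∀ n, Measurable (M n))
    (hind : iIndepFun M P) (hlaw : ∀ n, P.map (M n) = markLaw ν) {x r : ℝ} (hx : 0 < x)
    (hr3 : r ≤ 3)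
    (hpick : ∀ I : Config, ENNReal.ofReal (r * I.energy x)
      ≤ ∫⁻ u, ENNReal.ofReal (sqAbove x (I.quantile u)) ∂ν) (I : Config) (n : ℕ) :
    P {ω | ∃ a ∈ (I.chain (fun k => M k ω) n).1, x ≤ a}
      ≤ ENNReal.ofReal (x⁻¹ ^ 2 * Real.exp (-(r / 3 * n))) := by
  have hJ := measurable_chain hM I n
  have hint : Integrable (fun ω => (I.chain (fun k => M k ω) n).energy x) P :=
    integrable_of_measurable_of_mem_Icc ((Config.measurable_energy x).comp hJ) fun ω =>
      ⟨Config.energy_nonneg _ _, Config.energy_le_one _ _⟩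
  have hmarkov := mul_meas_ge_le_integral_of_nonneg
    (ae_of_all P fun ω => Config.energy_nonneg x (I.chain (fun k => M k ω) n)) hint (x ^ 2)
  have hmean := integral_energy_chain_le hν hM hind hlaw hr3 hpick I n
  have hpow : (1 - r / 3) ^ n ≤ Real.exp (-(r / 3 * n)) := by
    rw [show -(r / 3 * n) = n * (-(r / 3)) by ring, Real.exp_nat_mul]
    exact pow_le_pow_left₀ (by linarith) (by linarith [Real.add_one_le_exp (-(r / 3))]) n
  calc P {ω | ∃ a ∈ (I.chain (fun k => M k ω) n).1, x ≤ a}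
      ≤ P {ω | x ^ 2 ≤ (I.chain (fun k => M k ω) n).energy x} :=
        measure_mono fun ω hω => Config.sq_le_energy hx.le _ hω
    _ = ENNReal.ofReal (P.real {ω | x ^ 2 ≤ (I.chain (fun k => M k ω) n).energy x}) := by
        rw [ofReal_measureReal]
    _ ≤ _ := by
        refine ENNReal.ofReal_le_ofReal ?_
        rw [inv_pow, inv_mul_eq_div, le_div_iff₀ (by positivity), mul_comm]
        linarith

end Chain

/-! ### Poisson random measures and counting points -/

section PoissonRandomMeasure

variable {Ω : Type*} [MeasurableSpace Ω] {P : Measure Ω} {E : Type*} [MeasurableSpace E]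
  {N : Ω → Measure E} {μ : Measure E}

theorem IsPoissonRandomMeasure.measurable_apply (h : IsPoissonRandomMeasure N μ P) {A : Set E}
    (hA : MeasurableSet A) : Measurable fun ω => N ω A :=
  (Measure.measurable_coe hA).comp h.measurable

theorem IsPoissonRandomMeasure.measure_preimage (h : IsPoissonRandomMeasure N μ P) {A : Set E}
    (hA : MeasurableSet A) (hμ : μ A ≠ ∞) {s : Set ℝ≥0∞} (hs : MeasurableSet s) :
    P {ω | N ω A ∈ s} = poissonMeasure (μ A).toNNReal ((fun k : ℕ => (k : ℝ≥0∞)) ⁻¹' s) := by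
  have := congrArg (fun m => m s) (h.law_of_finite A hA hμ)
  rwa [Measure.map_apply (h.measurable_apply hA) hs, Measure.map_apply .of_discrete hs] at this

theorem IsPoissonRandomMeasure.measure_eq_natCast (h : IsPoissonRandomMeasure N μ P) {A : Set E}
    (hA : MeasurableSet A) (hμ : μ A ≠ ∞) (k : ℕ) :
    P {ω | N ω A = k} = ENNReal.ofReal
      (Real.exp (-(μ A).toReal) * (μ A).toReal ^ k / (k.factorial : ℝ)) := by
  have := h.measure_preimage hA hμ (measurableSet_singleton (k : ℝ≥0∞))
  have hpre : (fun k : ℕ => (k : ℝ≥0∞)) ⁻¹' {(k : ℝ≥0∞)} = {k} := by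
    ext j
    simp
  rw [hpre, poissonMeasure_singleton] at this
  simpa only [mem_singleton_iff, ENNReal.coe_toNNReal_eq_toReal] using this

theorem IsPoissonRandomMeasure.measure_eq_zero (h : IsPoissonRandomMeasure N μ P) {A : Set E}
    (hA : MeasurableSet A) (hμ : μ A ≠ ∞) :
    P {ω | N ω A = 0} = ENNReal.ofReal (Real.exp (-(μ A).toReal)) := by
  simpa using h.measure_eq_natCast hA hμ 0

theorem IsPoissonRandomMeasure.measure_eq_one (h : IsPoissonRandomMeasure N μ P) {A : Set E}
    (hA : MeasurableSet A) (hμ : μ A ≠ ∞) :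
    P {ω | N ω A = 1} = ENNReal.ofReal (Real.exp (-(μ A).toReal) * (μ A).toReal) := by
  simpa using h.measure_eq_natCast hA hμ 1

theorem IsPoissonRandomMeasure.measure_ne_zero_le [IsProbabilityMeasure P]
    (h : IsPoissonRandomMeasure N μ P) {A : Set E} (hA : MeasurableSet A) (hμ : μ A ≠ ∞) :
    P {ω | N ω A ≠ 0} ≤ μ A := by
  have hm : MeasurableSet {ω | N ω A = 0} :=
    h.measurable_apply hA (measurableSet_singleton 0)
  change P {ω | N ω A = 0}ᶜ ≤ _
  rw [prob_compl_eq_one_sub hm, h.measure_eq_zero hA hμ, ← ENNReal.ofReal_one,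
    ← ENNReal.ofReal_sub _ (Real.exp_nonneg _)]
  refine ENNReal.ofReal_le_of_le_toReal ?_
  linarith [Real.add_one_le_exp (-(μ A).toReal)]

theorem IsPoissonRandomMeasure.ae_ne_top [IsProbabilityMeasure P]
    (h : IsPoissonRandomMeasure N μ P) {A : Set E} (hA : MeasurableSet A) (hμ : μ A ≠ ∞) :
    ∀ᵐ ω ∂P, N ω A ≠ ∞ := by
  rw [ae_iff]
  have := h.measure_preimage hA hμ (measurableSet_singleton ∞)
  have hpre : (fun k : ℕ => (k : ℝ≥0∞)) ⁻¹' {∞} = ∅ := by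
    ext j
    simp
  rw [hpre, measure_empty] at this
  simpa using this

/-- A Chernoff bound for the lower tail of the Poisson law: compare with the generating function at
`1/2`. -/
theorem poissonMeasure_Iic_le (r : ℝ≥0) (k : ℕ) :
    poissonMeasure r (Iic k) ≤ ENNReal.ofReal (2 ^ k * Real.exp (-r / 2)) := by
  have hs := (hasSum_one_poissonMeasure (r / 2)).mul_left (2 ^ k * Real.exp (-r / 2))
  have hle : ∀ n : ℕ, (Iic k).indicator (fun n : ℕ => Real.exp (-r) * r ^ n / n.factorial) n
      ≤ 2 ^ k * Real.exp (-r / 2) *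
        (Real.exp (-(r / 2 : ℝ≥0)) * (r / 2 : ℝ≥0) ^ n / n.factorial) := by
    intro n
    by_cases hn : n ∈ Iic k
    · rw [indicator_of_mem hn]
      have hpow : (1 : ℝ) ≤ 2 ^ k * (1 / 2) ^ n := by
        rw [one_div, inv_pow, ← div_eq_mul_inv, one_le_div (by positivity)]
        exact pow_le_pow_right₀ one_le_two hn
      have hexp : Real.exp (-r) = Real.exp (-r / 2) * Real.exp (-(r / 2 : ℝ≥0)) := by
        rw [← Real.exp_add]
        congr 1
        push_cast
        ring
      calc Real.exp (-r) * r ^ n / n.factorial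
          ≤ (2 ^ k * (1 / 2) ^ n) * (Real.exp (-r) * r ^ n / n.factorial) :=
            le_mul_of_one_le_left (by positivity) hpow
        _ = _ := by
            rw [hexp]
            push_cast
            rw [div_pow, div_pow]
            ring
    · rw [indicator_of_notMem hn]
      positivity
  have hnn : ∀ n : ℕ, 0 ≤ (Iic k).indicator
      (fun n : ℕ => Real.exp (-r) * (r : ℝ) ^ n / n.factorial) n :=
    fun n => indicator_nonneg (fun n _ => by positivity) n
  have hsummable := Summable.of_nonneg_of_le hnn hle hs.summable
  calc poissonMeasure r (Iic k)
      = ∑' n : ℕ, (Iic k).indicator (fun n => poissonMeasure r {n}) n := by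
        rw [Measure.tsum_indicator_apply_singleton _ _ (MeasurableSet.of_discrete)]
    _ = ∑' n : ℕ, ENNReal.ofReal ((Iic k).indicator
          (fun n : ℕ => Real.exp (-r) * (r : ℝ) ^ n / n.factorial) n) := by
        refine tsum_congr fun n => ?_
        by_cases hn : n ∈ Iic k
        · simp only [indicator_of_mem hn, poissonMeasure_singleton]
        · simp [indicator_of_notMem hn]
    _ = ENNReal.ofReal (∑' n : ℕ, (Iic k).indicator
          (fun n : ℕ => Real.exp (-r) * (r : ℝ) ^ n / n.factorial) n) :=
        (ENNReal.ofReal_tsum_of_nonneg hnn hsummable).symm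
    _ ≤ _ := by
        refine ENNReal.ofReal_le_ofReal ?_
        calc _ ≤ _ := hsummable.tsum_le_tsum hle hs.summable
          _ = _ := by rw [hs.tsum_eq, mul_one]

/-- The masses of a countable family of disjoint sets are independent. -/
theorem IsPoissonRandomMeasure.iIndepFun_of_disjoint (h : IsPoissonRandomMeasure N μ P)
    {ι : Type*} {A : ι → Set E} (hA : ∀ i, MeasurableSet (A i))
    (hd : Pairwise fun i j => Disjoint (A i) (A j)) : iIndepFun (fun i ω => N ω (A i)) P := by
  rw [iIndepFun_iff_measure_inter_preimage_eq_mul]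
  intro S sets hsets
  let e := S.equivFin
  have hfin := h.indep S.card (fun j => A (e.symm j)) (fun j => hA _) fun i j hij =>
    hd fun heq => hij (e.symm.injective (Subtype.ext heq))
  have hprod := hfin.measure_inter_preimage_eq_mul Finset.univ
    (sets := fun j => sets (e.symm j)) (fun j _ => hsets _ (e.symm j).2)
  have hinter : (⋂ i ∈ S, (fun ω => N ω (A i)) ⁻¹' sets i)
      = ⋂ j ∈ (Finset.univ : Finset (Fin S.card)),
        (fun ω => N ω (A (e.symm j))) ⁻¹' sets (e.symm j) := by
    ext ω
    simp only [mem_iInter, Finset.mem_univ, true_imp_iff]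
    refine ⟨fun H j => H _ (e.symm j).2, fun H i hi => ?_⟩
    have := H (e ⟨i, hi⟩)
    simpa using this
  rw [hinter, hprod, ← Finset.prod_coe_sort S, ← e.symm.prod_comp]

end PoissonRandomMeasure

/-- The mass of a set under a sum of Dirac masses is the number of atoms in it. -/
theorem sum_dirac_apply {E : Type*} [MeasurableSpace E] (p : ℕ → E) {A : Set E}
    (hA : MeasurableSet A) :
    (Measure.sum fun n => Measure.dirac (p n)) A = ({n | p n ∈ A}.encard : ℝ≥0∞) := by
  rw [Measure.sum_apply _ hA, ← Measure.count_apply (MeasurableSet.of_discrete),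
    Measure.count, Measure.sum_apply _ MeasurableSet.of_discrete]
  refine tsum_congr fun n => ?_
  rw [Measure.dirac_apply' _ hA, Measure.dirac_apply' _ MeasurableSet.of_discrete]
  rfl

theorem sum_dirac_eq_zero_iff {E : Type*} [MeasurableSpace E] (p : ℕ → E) {A : Set E}
    (hA : MeasurableSet A) :
    (Measure.sum fun n => Measure.dirac (p n)) A = 0 ↔ ∀ n, p n ∉ A := by
  rw [sum_dirac_apply p hA, ENat.toENNReal_eq_zero, encard_eq_zero, eq_empty_iff_forall_notMem]
  rfl

theorem sum_dirac_eq_one_iff {E : Type*} [MeasurableSpace E] (p : ℕ → E) {A : Set E}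
    (hA : MeasurableSet A) :
    (Measure.sum fun n => Measure.dirac (p n)) A = 1 ↔ ∃ n, ∀ k, p k ∈ A ↔ k = n := by
  rw [sum_dirac_apply p hA, ← ENat.toENNReal_one, ENat.toENNReal_inj, encard_eq_one]
  simp only [Set.ext_iff]
  rfl

theorem lintegral_exp_Ico {s t : ℝ} (hst : s ≤ t) :
    ∫⁻ x in Ico s t, ENNReal.ofReal (Real.exp x) = ENNReal.ofReal (Real.exp t - Real.exp s) := by
  rw [Measure.restrict_congr_set Ico_ae_eq_Ioc,
    ← ofReal_integral_eq_lintegral_ofReal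
      ((Real.continuous_exp.integrableOn_Icc).mono_set Ioc_subset_Icc_self)
      (ae_of_all _ fun x => (Real.exp_pos x).le),
    ← intervalIntegral.integral_of_le hst, integral_exp]

theorem intensity_Ico_prod (ν : Measure ℝ) [IsProbabilityMeasure ν] {s t : ℝ} (hs : 0 ≤ s)
    (hst : s ≤ t) (B : Set (ℝ × ℝ)) :
    intensity ν (Ico s t ×ˢ B) = ENNReal.ofReal (Real.exp t - Real.exp s) * markLaw ν B := by
  have hsf : SigmaFinite ((volume.restrict (Ici (0 : ℝ))).withDensity
      fun t => ENNReal.ofReal (Real.exp t)) :=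
    SigmaFinite.withDensity_of_ne_top (ae_of_all _ fun _ => ENNReal.ofReal_ne_top)
  rw [intensity, ← markLaw, Measure.prod_prod, withDensity_apply _ measurableSet_Ico,
    Measure.restrict_restrict measurableSet_Ico,
    inter_eq_left.2 (Ico_subset_Ici_self.trans (Ici_subset_Ici.2 hs)), lintegral_exp_Ico hst]

theorem intensity_Iio_zero_prod (ν : Measure ℝ) [IsProbabilityMeasure ν] (B : Set (ℝ × ℝ)) :
    intensity ν (Iio 0 ×ˢ B) = 0 := by
  rw [intensity, ← markLaw, Measure.prod_prod, withDensity_apply _ measurableSet_Iio,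
    Measure.restrict_restrict measurableSet_Iio, Iio_inter_Ici, Ico_self]
  simp

theorem intensity_Iio_prod (ν : Measure ℝ) [IsProbabilityMeasure ν] {t : ℝ} (ht : 0 ≤ t)
    {B : Set (ℝ × ℝ)} (hB : MeasurableSet B) :
    intensity ν (Iio t ×ˢ B) = ENNReal.ofReal (Real.exp t - 1) * markLaw ν B := by
  rw [← Iio_union_Ico_eq_Iio ht, union_prod, measure_union ?_ (measurableSet_Ico.prod hB),
    intensity_Iio_zero_prod, intensity_Ico_prod ν le_rfl ht, zero_add, Real.exp_zero]
  rw [Set.disjoint_prod]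
  exact Or.inl (disjoint_left.2 fun x hx hx' => absurd hx'.1 (not_le.2 hx))

/-! ### Grid events -/

/-- The `i`-th cell of the time grid of mesh `h`. -/
def gridCell (h : ℝ) (i : ℕ) : Set ℝ := Ico (i * h) ((i + 1 : ℕ) * h)

theorem mem_gridCell {h : ℝ} {i : ℕ} {t : ℝ} :
    t ∈ gridCell h i ↔ i * h ≤ t ∧ t < (i + 1 : ℕ) * h := Iff.rfl

theorem disjoint_gridCell {h : ℝ} (hh : 0 < h) {i j : ℕ} (hij : i ≠ j) :
    Disjoint (gridCell h i) (gridCell h j) := by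
  have key : ∀ i j : ℕ, i < j → Disjoint (gridCell h i) (gridCell h j) := by
    intro i j hij
    refine disjoint_left.2 fun t ht ht' => ?_
    have : ((i + 1 : ℕ) : ℝ) * h ≤ j * h := by
      gcongr
      exact hij
    linarith [ht.2, ht'.1]
  rcases lt_or_gt_of_ne hij with h | h
  · exact key i j h
  · exact (key j i h).symm

section Grid

variable {Ω : Type*}

/-- The event that the `i`-th cell contains a single point, and that its mark lies in `B`. -/
def singlePoint (N : Ω → Measure (ℝ × ℝ × ℝ)) (h : ℝ) (B : Set (ℝ × ℝ)) (i : ℕ) : Set Ω :=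
  {ω | N ω (gridCell h i ×ˢ B) = 1} ∩ {ω | N ω (gridCell h i ×ˢ Bᶜ) = 0}

/-- The event that the first `i` cells of the grid of mesh `h` contain exactly `n` points, all in
distinct cells, and that the mark of the `k`-th point lies in `B k`. It is defined by recursion over
the cells, in terms of the masses of the random measure only. -/
def gridEvent (N : Ω → Measure (ℝ × ℝ × ℝ)) (h : ℝ) (B : ℕ → Set (ℝ × ℝ)) : ℕ → ℕ → Set Ω
  | 0, 0 => univ
  | 0, _ + 1 => ∅
  | i + 1, 0 => gridEvent N h B i 0 ∩ {ω | N ω (gridCell h i ×ˢ univ) = 0}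
  | i + 1, n + 1 => (gridEvent N h B i (n + 1) ∩ {ω | N ω (gridCell h i ×ˢ univ) = 0}) ∪
      (gridEvent N h B i n ∩ singlePoint N h (B n) i)

/-- The atom of marks that lie in exactly those of the first `n` sets `B k` that are given by
`l`. -/
def markAtom (B : ℕ → Set (ℝ × ℝ)) (n : ℕ) (l : Set (Fin n)) : Set (ℝ × ℝ) :=
  {z | {k : Fin n | z ∈ B k} = l}

theorem measurableSet_markAtom {B : ℕ → Set (ℝ × ℝ)} (hB : ∀ k, MeasurableSet (B k)) (n : ℕ)
    (l : Set (Fin n)) : MeasurableSet (markAtom B n l) := by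
  have : markAtom B n l = ⋂ k : Fin n, {z | z ∈ B k ↔ k ∈ l} := by
    ext z
    simp only [markAtom, mem_ofPred_eq, Set.ext_iff, mem_iInter]
  rw [this]
  refine MeasurableSet.iInter fun k => ?_
  by_cases hk : k ∈ l
  · simpa [hk] using hB k
  · simp only [hk, iff_false]
    exact (hB k).compl

/-- Unions of atoms of marks: if `S` only depends on the membership in the first `n` sets `B k`,
the mass of `gridCell h i ×ˢ S` is the sum of the masses over the atoms contained in `S`. -/
theorem measurable_apply_gridCell_prod {N : Ω → Measure (ℝ × ℝ × ℝ)} {h : ℝ}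
    {B : ℕ → Set (ℝ × ℝ)} (hB : ∀ k, MeasurableSet (B k)) {n : ℕ} (T : Set (Set (Fin n))) (i : ℕ) :
    Measurable[⨆ j ∈ {j : ℕ × Set (Fin n) | j.1 = i}, MeasurableSpace.comap
        (fun ω => N ω (gridCell h j.1 ×ˢ markAtom B n j.2)) inferInstance]
      fun ω => N ω (gridCell h i ×ˢ {z | {k : Fin n | z ∈ B k} ∈ T}) := by
  classical
  have hset : gridCell h i ×ˢ {z : ℝ × ℝ | {k : Fin n | z ∈ B k} ∈ T}
      = ⋃ l ∈ T.toFinset, gridCell h i ×ˢ markAtom B n l := by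
    ext ⟨t, z⟩
    simp [markAtom, and_comm]
  have hsum : (fun ω => N ω (gridCell h i ×ˢ {z | {k : Fin n | z ∈ B k} ∈ T}))
      = fun ω => ∑ l ∈ T.toFinset, N ω (gridCell h i ×ˢ markAtom B n l) := by
    funext ω
    rw [hset, measure_biUnion_finset]
    · intro l _ l' _ hll
      refine disjoint_left.2 ?_
      rintro ⟨t, z⟩ h1 h2
      exact hll (h1.2.symm.trans h2.2)
    · exact fun l _ => measurableSet_Ico.prod (measurableSet_markAtom hB n l)
  rw [hsum]
  refine Finset.measurable_sum _ fun l _ => Measurable.of_comap_le ?_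
  exact le_iSup₂ (f := fun (j : ℕ × Set (Fin n)) (_ : j ∈ {j : ℕ × Set (Fin n) | j.1 = i}) =>
    MeasurableSpace.comap (fun ω => N ω (gridCell h j.1 ×ˢ markAtom B n j.2)) inferInstance)
      (i, l) rfl

theorem measurableSet_emptyCell_atoms {N : Ω → Measure (ℝ × ℝ × ℝ)} {h : ℝ}
    {B : ℕ → Set (ℝ × ℝ)} (hB : ∀ k, MeasurableSet (B k)) (n i : ℕ) :
    MeasurableSet[⨆ j ∈ {j : ℕ × Set (Fin n) | j.1 = i}, MeasurableSpace.comap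
        (fun ω => N ω (gridCell h j.1 ×ˢ markAtom B n j.2)) inferInstance]
      {ω | N ω (gridCell h i ×ˢ univ) = 0} := by
  have := measurable_apply_gridCell_prod (N := N) (h := h) hB (n := n) univ i
    (measurableSet_singleton 0)
  simp only [mem_univ] at this
  exact this

theorem measurableSet_singlePoint_atoms {N : Ω → Measure (ℝ × ℝ × ℝ)} {h : ℝ}
    {B : ℕ → Set (ℝ × ℝ)} (hB : ∀ k, MeasurableSet (B k)) {n : ℕ} (m : Fin n) (i : ℕ) :
    MeasurableSet[⨆ j ∈ {j : ℕ × Set (Fin n) | j.1 = i}, MeasurableSpace.comap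
        (fun ω => N ω (gridCell h j.1 ×ˢ markAtom B n j.2)) inferInstance]
      (singlePoint N h (B m) i) := by
  have h1 := measurable_apply_gridCell_prod (N := N) (h := h) hB (n := n) {l | m ∈ l} i
    (measurableSet_singleton 1)
  have h2 := measurable_apply_gridCell_prod (N := N) (h := h) hB (n := n) {l | m ∉ l} i
    (measurableSet_singleton 0)
  exact h1.inter h2

theorem measurableSet_gridEvent_atoms {N : Ω → Measure (ℝ × ℝ × ℝ)} {h : ℝ}
    {B : ℕ → Set (ℝ × ℝ)} (hB : ∀ k, MeasurableSet (B k)) (n : ℕ) (i m : ℕ) (hm : m ≤ n) :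
    MeasurableSet[⨆ j ∈ {j : ℕ × Set (Fin n) | j.1 < i}, MeasurableSpace.comap
        (fun ω => N ω (gridCell h j.1 ×ˢ markAtom B n j.2)) inferInstance]
      (gridEvent N h B i m) := by
  induction i generalizing m with
  | zero =>
    cases m with
    | zero => exact @MeasurableSet.univ Ω (_)
    | succ m => exact @MeasurableSet.empty Ω (_)
  | succ i ih =>
    have hpast : (⨆ j ∈ {j : ℕ × Set (Fin n) | j.1 < i}, MeasurableSpace.comap
        (fun ω => N ω (gridCell h j.1 ×ˢ markAtom B n j.2)) inferInstance)
        ≤ ⨆ j ∈ {j : ℕ × Set (Fin n) | j.1 < i + 1}, MeasurableSpace.comap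
        (fun ω => N ω (gridCell h j.1 ×ˢ markAtom B n j.2)) inferInstance :=
      biSup_mono fun j (hj : j.1 < i) => hj.trans i.lt_succ_self
    have hcell : (⨆ j ∈ {j : ℕ × Set (Fin n) | j.1 = i}, MeasurableSpace.comap
        (fun ω => N ω (gridCell h j.1 ×ˢ markAtom B n j.2)) inferInstance)
        ≤ ⨆ j ∈ {j : ℕ × Set (Fin n) | j.1 < i + 1}, MeasurableSpace.comap
        (fun ω => N ω (gridCell h j.1 ×ˢ markAtom B n j.2)) inferInstance :=
      biSup_mono fun j (hj : j.1 = i) => hj.trans_lt i.lt_succ_self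
    cases m with
    | zero =>
      exact (hpast _ (ih 0 hm)).inter (hcell _ (measurableSet_emptyCell_atoms hB n i))
    | succ m =>
      exact ((hpast _ (ih _ hm)).inter (hcell _ (measurableSet_emptyCell_atoms hB n i))).union
        ((hpast _ (ih m (by omega))).inter
          (hcell _ (measurableSet_singlePoint_atoms hB ⟨m, hm⟩ i)))

variable [MeasurableSpace Ω] {P : Measure Ω} {N : Ω → Measure (ℝ × ℝ × ℝ)} {ν : Measure ℝ}

/-- What happens in the `i`-th cell is independent of the grid events of the preceding cells. -/
theorem measure_gridEvent_inter (hN : IsPoissonRandomMeasure N (intensity ν) P) {h : ℝ}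
    (hh : 0 < h) {B : ℕ → Set (ℝ × ℝ)} (hB : ∀ k, MeasurableSet (B k)) {n i m : ℕ} (hm : m ≤ n)
    {F : Set Ω} (hF : MeasurableSet[⨆ j ∈ {j : ℕ × Set (Fin n) | j.1 = i}, MeasurableSpace.comap
        (fun ω => N ω (gridCell h j.1 ×ˢ markAtom B n j.2)) inferInstance] F) :
    P (gridEvent N h B i m ∩ F) = P (gridEvent N h B i m) * P F := by
  have hmeas : ∀ j : ℕ × Set (Fin n), MeasurableSet (gridCell h j.1 ×ˢ markAtom B n j.2) :=
    fun j => measurableSet_Ico.prod (measurableSet_markAtom hB n j.2)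
  have hind : iIndepFun (fun (j : ℕ × Set (Fin n)) ω =>
      N ω (gridCell h j.1 ×ˢ markAtom B n j.2)) P := by
    refine hN.iIndepFun_of_disjoint hmeas ?_
    rintro ⟨i, l⟩ ⟨i', l'⟩ hne
    rw [Set.disjoint_prod]
    by_cases hi : i = i'
    · right
      refine disjoint_left.2 fun z hz hz' => hne ?_
      exact Prod.ext hi (hz.symm.trans hz')
    · exact Or.inl (disjoint_gridCell hh hi)
  have hST : Disjoint {j : ℕ × Set (Fin n) | j.1 < i} {j : ℕ × Set (Fin n) | j.1 = i} :=
    disjoint_left.2 fun j (hj : j.1 < i) (hj' : j.1 = i) => absurd hj' hj.ne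
  exact (Indep_iff _ _ P).1 (indep_iSup_of_disjoint
    (fun j => (hN.measurable_apply (hmeas j)).comap_le) hind hST) _ _
      (measurableSet_gridEvent_atoms hB n i m hm) hF

theorem measurableSet_singlePoint (hN : IsPoissonRandomMeasure N (intensity ν) P) {h : ℝ}
    {B : Set (ℝ × ℝ)} (hB : MeasurableSet B) (i : ℕ) : MeasurableSet (singlePoint N h B i) :=
  ((hN.measurable_apply (measurableSet_Ico.prod hB)) (measurableSet_singleton 1)).inter
    ((hN.measurable_apply (measurableSet_Ico.prod hB.compl)) (measurableSet_singleton 0))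

theorem measurableSet_gridEvent (hN : IsPoissonRandomMeasure N (intensity ν) P) {h : ℝ}
    {B : ℕ → Set (ℝ × ℝ)} (hB : ∀ k, MeasurableSet (B k)) (i n : ℕ) :
    MeasurableSet (gridEvent N h B i n) := by
  refine (iSup₂_le fun j _ => ?_ : (⨆ j ∈ {j : ℕ × Set (Fin n) | j.1 < i}, MeasurableSpace.comap
    (fun ω => N ω (gridCell h j.1 ×ˢ markAtom B n j.2)) inferInstance) ≤ _) _
      (measurableSet_gridEvent_atoms hB n i n le_rfl)
  exact (hN.measurable_apply (measurableSet_Ico.prod (measurableSet_markAtom hB n j.2))).comap_le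

theorem measure_gridEvent_succ_zero (hN : IsPoissonRandomMeasure N (intensity ν) P) {h : ℝ}
    (hh : 0 < h) {B : ℕ → Set (ℝ × ℝ)} (hB : ∀ k, MeasurableSet (B k)) (i : ℕ) :
    P (gridEvent N h B (i + 1) 0)
      = P (gridEvent N h B i 0) * P {ω | N ω (gridCell h i ×ˢ univ) = 0} :=
  measure_gridEvent_inter hN hh hB le_rfl (measurableSet_emptyCell_atoms hB 0 i)

/-- The expected number of points in the `i`-th cell. -/
def cellMass (h : ℝ) (i : ℕ) : ℝ := Real.exp ((i + 1 : ℕ) * h) - Real.exp (i * h)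

theorem cellMass_nonneg {h : ℝ} (hh : 0 < h) (i : ℕ) : 0 ≤ cellMass h i := by
  refine sub_nonneg.2 (Real.exp_le_exp.2 ?_)
  gcongr
  exact i.le_succ

theorem intensity_gridCell_prod (ν : Measure ℝ) [IsProbabilityMeasure ν] {h : ℝ} (hh : 0 < h)
    (i : ℕ) (B : Set (ℝ × ℝ)) :
    intensity ν (gridCell h i ×ˢ B) = ENNReal.ofReal (cellMass h i) * markLaw ν B := by
  refine intensity_Ico_prod ν (by positivity) ?_ B
  gcongr
  exact i.le_succ

theorem intensity_gridCell_prod_ne_top (ν : Measure ℝ) [IsProbabilityMeasure ν] {h : ℝ}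
    (hh : 0 < h) (i : ℕ) (B : Set (ℝ × ℝ)) : intensity ν (gridCell h i ×ˢ B) ≠ ∞ := by
  rw [intensity_gridCell_prod ν hh]
  exact ENNReal.mul_ne_top ENNReal.ofReal_ne_top (measure_ne_top _ _)

theorem toReal_intensity_gridCell_prod (ν : Measure ℝ) [IsProbabilityMeasure ν] {h : ℝ}
    (hh : 0 < h) (i : ℕ) (B : Set (ℝ × ℝ)) :
    (intensity ν (gridCell h i ×ˢ B)).toReal = cellMass h i * (markLaw ν).real B := by
  rw [intensity_gridCell_prod ν hh, ENNReal.toReal_mul,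
    ENNReal.toReal_ofReal (cellMass_nonneg hh i)]
  rfl

variable [IsProbabilityMeasure ν]

/-- Given that a cell contains a single point, the mark of this point has the law `markLaw ν`. -/
theorem measure_singlePoint (hN : IsPoissonRandomMeasure N (intensity ν) P) {h : ℝ}
    (hh : 0 < h) {B : Set (ℝ × ℝ)} (hB : MeasurableSet B) (i : ℕ) :
    P (singlePoint N h B i)
      = markLaw ν B * ENNReal.ofReal (cellMass h i * Real.exp (-cellMass h i)) := by
  have hc : MeasurableSet (gridCell h i) := measurableSet_Ico
  let A : Fin 2 → Set (ℝ × ℝ × ℝ) := ![gridCell h i ×ˢ B, gridCell h i ×ˢ Bᶜ]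
  have hA : ∀ j, MeasurableSet (A j) := by
    intro j
    fin_cases j
    · exact hc.prod hB
    · exact hc.prod hB.compl
  have hAd : Pairwise fun j j' => Disjoint (A j) (A j') := by
    have h01 : Disjoint (A 0) (A 1) := Set.disjoint_prod.2 (Or.inr disjoint_compl_right)
    intro j j' hjj
    fin_cases j <;> fin_cases j'
    · exact absurd rfl hjj
    · exact h01
    · exact h01.symm
    · exact absurd rfl hjj
  have hind := (hN.iIndepFun_of_disjoint hA hAd).indepFun (show (0 : Fin 2) ≠ 1 by simp)
  have hprod := hind.measure_inter_preimage_eq_mul {1} {0} (measurableSet_singleton _)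
    (measurableSet_singleton _)
  have h1 := hN.measure_eq_one (hc.prod hB) (intensity_gridCell_prod_ne_top ν hh i B)
  have h2 := hN.measure_eq_zero (hc.prod hB.compl) (intensity_gridCell_prod_ne_top ν hh i Bᶜ)
  rw [toReal_intensity_gridCell_prod ν hh] at h1 h2
  have hP : P (singlePoint N h B i) = P {ω | N ω (gridCell h i ×ˢ B) = 1}
      * P {ω | N ω (gridCell h i ×ˢ Bᶜ) = 0} := hprod
  rw [hP, h1, h2, ← ENNReal.ofReal_mul (mul_nonneg (Real.exp_nonneg _)
    (mul_nonneg (cellMass_nonneg hh i) measureReal_nonneg)), ← ofReal_measureReal (μ := markLaw ν),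
    ← ENNReal.ofReal_mul measureReal_nonneg]
  congr 1
  have hexp : Real.exp (-cellMass h i) = Real.exp (-(cellMass h i * (markLaw ν).real B))
      * Real.exp (-(cellMass h i * (markLaw ν).real Bᶜ)) := by
    rw [← Real.exp_add, measureReal_compl hB, probReal_univ]
    congr 1
    ring
  rw [hexp]
  ring

theorem measure_gridEvent_inter_singlePoint (hN : IsPoissonRandomMeasure N (intensity ν) P)
    {h : ℝ} (hh : 0 < h) {B : ℕ → Set (ℝ × ℝ)} (hB : ∀ k, MeasurableSet (B k)) (i n : ℕ) :
    P (gridEvent N h B i n ∩ singlePoint N h (B n) i) = P (gridEvent N h B i n) *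
      (markLaw ν (B n) * ENNReal.ofReal (cellMass h i * Real.exp (-cellMass h i))) := by
  rw [measure_gridEvent_inter hN hh hB n.le_succ
    (measurableSet_singlePoint_atoms hB ⟨n, n.lt_succ_self⟩ i), measure_singlePoint hN hh (hB n)]

theorem measure_gridEvent_succ_succ (hN : IsPoissonRandomMeasure N (intensity ν) P) {h : ℝ}
    (hh : 0 < h) {B : ℕ → Set (ℝ × ℝ)} (hB : ∀ k, MeasurableSet (B k)) (i n : ℕ) :
    P (gridEvent N h B (i + 1) (n + 1))
      = P (gridEvent N h B i (n + 1)) * P {ω | N ω (gridCell h i ×ˢ univ) = 0}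
        + P (gridEvent N h B i n) *
          (markLaw ν (B n) * ENNReal.ofReal (cellMass h i * Real.exp (-cellMass h i))) := by
  have hdisj : Disjoint (gridEvent N h B i (n + 1) ∩ {ω | N ω (gridCell h i ×ˢ univ) = 0})
      (gridEvent N h B i n ∩ singlePoint N h (B n) i) := by
    refine disjoint_left.2 fun ω h0 h1 => ?_
    have hle : N ω (gridCell h i ×ˢ B n) ≤ N ω (gridCell h i ×ˢ univ) :=
      measure_mono (prod_mono_right (subset_univ _))
    have h0' : N ω (gridCell h i ×ˢ univ) = 0 := h0.2
    have h1' : N ω (gridCell h i ×ˢ B n) = 1 := h1.2.1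
    rw [h0', h1'] at hle
    simp at hle
  rw [gridEvent, measure_union hdisj ((measurableSet_gridEvent hN hB i n).inter
    (measurableSet_singlePoint hN (hB n) i)), measure_gridEvent_inter_singlePoint hN hh hB,
    measure_gridEvent_inter hN hh hB le_rfl (measurableSet_emptyCell_atoms hB (n + 1) i)]

/-- On the grid the marks are independent of the positions of the occupied cells. -/
theorem measure_gridEvent_eq (hN : IsPoissonRandomMeasure N (intensity ν) P) {h : ℝ}
    (hh : 0 < h) {B : ℕ → Set (ℝ × ℝ)} (hB : ∀ k, MeasurableSet (B k)) (i n : ℕ) :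
    P (gridEvent N h B i n)
      = (∏ k ∈ Finset.range n, markLaw ν (B k)) * P (gridEvent N h (fun _ => univ) i n) := by
  have hU : ∀ _k : ℕ, MeasurableSet (univ : Set (ℝ × ℝ)) := fun _ => MeasurableSet.univ
  induction i generalizing n with
  | zero =>
    cases n with
    | zero => simp [gridEvent]
    | succ n => simp [gridEvent]
  | succ i ih =>
    cases n with
    | zero =>
      rw [measure_gridEvent_succ_zero hN hh hB, measure_gridEvent_succ_zero hN hh hU, ih 0,
        mul_assoc]
    | succ n =>
      rw [measure_gridEvent_succ_succ hN hh hB, measure_gridEvent_succ_succ hN hh hU, ih (n + 1),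
        ih n, Finset.prod_range_succ, measure_univ]
      ring

end Grid

/-! ### Independence of the marks -/

section Marks

variable {Ω : Type*} {p : ℕ → Ω → ℝ × ℝ × ℝ} {ω : Ω} {h : ℝ} {B : ℕ → Set (ℝ × ℝ)}

theorem mem_singlePoint_iff {S : Set (ℝ × ℝ)} (hS : MeasurableSet S) (i : ℕ) :
    ω ∈ singlePoint (fun ω => Measure.sum fun n => Measure.dirac (p n ω)) h S i ↔
      ∃ n, (∀ k, (p k ω).1 ∈ gridCell h i ↔ k = n) ∧ (p n ω).2 ∈ S := by
  have hc : MeasurableSet (gridCell h i) := measurableSet_Ico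
  have h1 := sum_dirac_eq_one_iff (fun n => p n ω) (hc.prod hS)
  have h0 := sum_dirac_eq_zero_iff (fun n => p n ω) (hc.prod hS.compl)
  simp only [mem_prod, mem_compl_iff, not_and, not_not] at h1 h0
  constructor
  · rintro ⟨hω1, hω0⟩
    obtain ⟨n, hn⟩ := h1.1 hω1
    have hall := h0.1 hω0
    exact ⟨n, fun k => ⟨fun hk => (hn k).1 ⟨hk, hall k hk⟩, fun hk => ((hn k).2 hk).1⟩,
      ((hn n).2 rfl).2⟩
  · rintro ⟨n, hn, hnS⟩
    refine ⟨h1.2 ⟨n, fun k => ⟨fun hk => (hn k).1 hk.1, ?_⟩⟩, h0.2 fun k hk => ?_⟩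
    · rintro rfl
      exact ⟨(hn k).2 rfl, hnS⟩
    · rw [(hn k).1 hk]
      exact hnS

theorem apply_gridCell_eq_zero_iff (i : ℕ) :
    (Measure.sum fun n => Measure.dirac (p n ω)) (gridCell h i ×ˢ univ) = 0 ↔
      ∀ k, (p k ω).1 ∉ gridCell h i := by
  have hc : MeasurableSet (gridCell h i) := measurableSet_Ico
  rw [sum_dirac_eq_zero_iff (fun n => p n ω) (hc.prod MeasurableSet.univ)]
  simp

theorem lt_succ_mul_iff (i k : ℕ) (hh : 0 < h) :
    (p k ω).1 < (i + 1 : ℕ) * h ↔ (p k ω).1 < i * h ∨ (p k ω).1 ∈ gridCell h i := by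
  have : (i : ℝ) * h ≤ (i + 1 : ℕ) * h := by
    gcongr
    exact i.le_succ
  rw [mem_gridCell]
  constructor
  · intro H
    rcases lt_or_ge (p k ω).1 (i * h) with h1 | h1
    · exact Or.inl h1
    · exact Or.inr ⟨h1, H⟩
  · rintro (H | H)
    · exact H.trans_le this
    · exact H.2

/-- If a cell contains a single point and exactly `n` points precede the cell, then this point has
index `n`. -/
theorem eq_of_single_of_preceding (hmono : StrictMono fun k => (p k ω).1) {i n m : ℕ}
    (hm : ∀ k, (p k ω).1 ∈ gridCell h i ↔ k = m) (hn : ∀ k, (p k ω).1 < i * h ↔ k < n) :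
    m = n := by
  have hmc := (hm m).2 rfl
  have hnm : n ≤ m := by
    by_contra! hcon
    exact absurd ((hn m).2 hcon) (not_lt.2 hmc.1)
  have hnc : (p n ω).1 ∈ gridCell h i :=
    ⟨not_lt.1 fun hcon => lt_irrefl n ((hn n).1 hcon),
      (hmono.monotone hnm).trans_lt hmc.2⟩
  exact ((hm n).1 hnc).symm

/-- The grid event implies what its description says about the points. -/
theorem of_mem_gridEvent (hh : 0 < h) (hB : ∀ k, MeasurableSet (B k))
    (hmono : StrictMono fun k => (p k ω).1) (hpos : ∀ k, 0 ≤ (p k ω).1) (i n : ℕ)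
    (hω : ω ∈ gridEvent (fun ω => Measure.sum fun n => Measure.dirac (p n ω)) h B i n) :
    (∀ k, (p k ω).1 < i * h ↔ k < n) ∧ ∀ k < n, (p k ω).2 ∈ B k := by
  induction i generalizing n with
  | zero =>
    cases n with
    | zero => simpa using hpos
    | succ n => exact absurd hω (notMem_empty ω)
  | succ i ih =>
    have hempty : ∀ n, (∀ k, (p k ω).1 < i * h ↔ k < n) →
        (Measure.sum fun n => Measure.dirac (p n ω)) (gridCell h i ×ˢ univ) = 0 →
        ∀ k, (p k ω).1 < (i + 1 : ℕ) * h ↔ k < n := by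
      intro n hn h0 k
      rw [lt_succ_mul_iff i k hh, hn k]
      exact or_iff_left ((apply_gridCell_eq_zero_iff i).1 h0 k)
    cases n with
    | zero =>
      obtain ⟨h1, h2⟩ := ih 0 hω.1
      exact ⟨hempty 0 h1 hω.2, h2⟩
    | succ n =>
      rcases hω with hω | hω
      · obtain ⟨h1, h2⟩ := ih (n + 1) hω.1
        exact ⟨hempty (n + 1) h1 hω.2, h2⟩
      · obtain ⟨h1, h2⟩ := ih n hω.1
        obtain ⟨m, hm, hmB⟩ := (mem_singlePoint_iff (hB n) i).1 hω.2
        obtain rfl := eq_of_single_of_preceding hmono hm h1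
        constructor
        · intro k
          rw [lt_succ_mul_iff i k hh, h1 k, hm k, Nat.lt_succ_iff_lt_or_eq]
        · intro k hk
          rcases Nat.lt_succ_iff_lt_or_eq.1 hk with hk | rfl
          · exact h2 k hk
          · exact hmB

/-- Points that are at least `h` apart lie in distinct cells. -/
theorem preceding_iff_of_gap (hmono : StrictMono fun k => (p k ω).1) {i n : ℕ}
    (hn : (p n ω).1 ∈ gridCell h i) (hgap : ∀ k < n, (p k ω).1 + h ≤ (p (k + 1) ω).1) (k : ℕ) :
    (p k ω).1 < i * h ↔ k < n := by
  constructor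
  · intro hk
    by_contra! hcon
    have h1 : (p n ω).1 ≤ (p k ω).1 := hmono.monotone hcon
    linarith [hn.1]
  · intro hk
    have h1 : (p (k + 1) ω).1 ≤ (p n ω).1 := hmono.monotone hk
    have h2 := hn.2
    push_cast at h2
    linarith [hgap k hk]

/-- If consecutive points are at least `h` apart, then the grid event occurs. -/
theorem mem_gridEvent_of_gap (hh : 0 < h) (hB : ∀ k, MeasurableSet (B k))
    (hmono : StrictMono fun k => (p k ω).1) (hpos : ∀ k, 0 ≤ (p k ω).1) (i n : ℕ)
    (hn : ∀ k, (p k ω).1 < i * h ↔ k < n) (hgap : ∀ k < n, (p k ω).1 + h ≤ (p (k + 1) ω).1)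
    (hmark : ∀ k < n, (p k ω).2 ∈ B k) :
    ω ∈ gridEvent (fun ω => Measure.sum fun n => Measure.dirac (p n ω)) h B i n := by
  induction i generalizing n with
  | zero =>
    cases n with
    | zero => exact mem_univ ω
    | succ n =>
      have := (hn 0).2 n.succ_pos
      simp only [CharP.cast_eq_zero, zero_mul] at this
      exact absurd this (not_lt.2 (hpos 0))
  | succ i ih =>
    simp only [lt_succ_mul_iff i _ hh] at hn
    cases n with
    | zero =>
      have hnone : ∀ k, ¬ (p k ω).1 < i * h ∧ (p k ω).1 ∉ gridCell h i := by
        intro k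
        have := hn k
        simp only [not_lt_zero, iff_false] at this
        exact not_or.1 this
      exact ⟨ih 0 (fun k => by simpa using (hnone k).1) hgap hmark,
        (apply_gridCell_eq_zero_iff i).2 fun k => (hnone k).2⟩
    | succ n =>
      rcases (hn n).2 n.lt_succ_self with hlast | hlast
      · have hle : ∀ k < n + 1, (p k ω).1 < i * h := fun k hk =>
          (hmono.monotone (Nat.lt_succ_iff.1 hk)).trans_lt hlast
        refine Or.inl ⟨ih (n + 1) (fun k => ⟨fun hk => (hn k).1 (Or.inl hk), hle k⟩) hgap hmark,
          (apply_gridCell_eq_zero_iff i).2 fun k hk => ?_⟩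
        exact absurd (hle k ((hn k).1 (Or.inr hk))) (not_lt.2 hk.1)
      · have hgap' : ∀ k < n, (p k ω).1 + h ≤ (p (k + 1) ω).1 := fun k hk =>
          hgap k (hk.trans n.lt_succ_self)
        have hprec := preceding_iff_of_gap hmono hlast hgap'
        refine Or.inr ⟨ih n hprec hgap' fun k hk => hmark k (hk.trans n.lt_succ_self),
          (mem_singlePoint_iff (hB n) i).2 ⟨n, fun k => ⟨fun hk => ?_, ?_⟩,
            hmark n n.lt_succ_self⟩⟩
        · refine (Nat.lt_succ_iff.1 ((hn k).1 (Or.inr hk))).antisymm (not_lt.1 fun hkn => ?_)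
          exact absurd ((hprec k).2 hkn) (not_lt.2 hk.1)
        · rintro rfl
          exact hlast

/-- If consecutive points are at least `h` apart, then the point of index `n` is alone in its
cell. -/
theorem mem_singlePoint_of_gap (hmono : StrictMono fun k => (p k ω).1) {i n : ℕ} {S : Set (ℝ × ℝ)}
    (hS : MeasurableSet S) (hn : (p n ω).1 ∈ gridCell h i)
    (hgap : ∀ k ≤ n, (p k ω).1 + h ≤ (p (k + 1) ω).1) (hmark : (p n ω).2 ∈ S) :
    ω ∈ singlePoint (fun ω => Measure.sum fun n => Measure.dirac (p n ω)) h S i := by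
  refine (mem_singlePoint_iff hS i).2 ⟨n, fun k => ⟨fun hk => ?_, ?_⟩, hmark⟩
  · rcases lt_trichotomy k n with hkn | hkn | hkn
    · have := (preceding_iff_of_gap hmono hn (fun k hk => hgap k hk.le) k).2 hkn
      exact absurd this (not_lt.2 hk.1)
    · exact hkn
    · have h1 : (p (n + 1) ω).1 ≤ (p k ω).1 := hmono.monotone hkn
      have h2 := hk.2
      push_cast at h2
      linarith [hgap n le_rfl, hn.1]
  · rintro rfl
    exact hn

variable [MeasurableSpace Ω] {P : Measure Ω} [IsProbabilityMeasure P] {ν : Measure ℝ}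
  [IsProbabilityMeasure ν]

theorem ae_time_nonneg (hN : IsPoissonRandomMeasure
    (fun ω => Measure.sum fun n => Measure.dirac (p n ω)) (intensity ν) P) :
    ∀ᵐ ω ∂P, ∀ k, 0 ≤ (p k ω).1 := by
  have hA : MeasurableSet (Iio (0 : ℝ) ×ˢ (univ : Set (ℝ × ℝ))) :=
    measurableSet_Iio.prod MeasurableSet.univ
  have h0 := intensity_Iio_zero_prod ν univ
  have h := hN.measure_ne_zero_le hA (by rw [h0]; exact ENNReal.zero_ne_top)
  rw [h0, nonpos_iff_eq_zero] at h
  filter_upwards [measure_eq_zero_iff_ae_notMem.1 h] with ω hω k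
  have := (sum_dirac_eq_zero_iff (fun n => p n ω) hA).1 (by simpa using hω) k
  simpa using this

/-- The marks of the first `n + 1` points are independent with law `markLaw ν`. With a grid of mesh
`h` this holds exactly for the points that are alone in their cells, and by strict monotonicity of
the times all of them are, with probability tending to `1` as `h → 0`. -/
theorem measure_marks_eq (hp : ∀ n, Measurable (p n))
    (hmono : ∀ᵐ ω ∂P, StrictMono fun k => (p k ω).1)
    (hN : IsPoissonRandomMeasure
      (fun ω => Measure.sum fun n => Measure.dirac (p n ω)) (intensity ν) P)
    (hB : ∀ k, MeasurableSet (B k)) (n : ℕ) :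
    P {ω | ∀ k ≤ n, (p k ω).2 ∈ B k} = ∏ k ∈ Finset.range (n + 1), markLaw ν (B k) := by
  set N : Ω → Measure (ℝ × ℝ × ℝ) := fun ω => Measure.sum fun n => Measure.dirac (p n ω) with hNdef
  set Z : ℝ → (ℕ → Set (ℝ × ℝ)) → ℕ → Set Ω :=
    fun h B i => gridEvent N h B i n ∩ singlePoint N h (B n) i with hZ
  set gap : ℕ → Set Ω := fun r =>
    {ω | ∀ k ≤ n, (p k ω).1 + 1 / ((r : ℝ) + 1) ≤ (p (k + 1) ω).1} with hgapdef
  have hgapmeas : ∀ r, MeasurableSet (gap r) := by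
    intro r
    have : gap r = ⋂ k, ⋂ (_ : k ≤ n), {ω | (p k ω).1 + 1 / ((r : ℝ) + 1) ≤ (p (k + 1) ω).1} := by
      ext ω
      simp [hgapdef]
    rw [this]
    exact MeasurableSet.iInter fun k => MeasurableSet.iInter fun _ =>
      measurableSet_le ((hp k).fst.add_const _) (hp (k + 1)).fst
  have hgapmono : Monotone gap := by
    intro r s hrs ω hω k hk
    have h1 := hω k hk
    have h2 : 1 / ((s : ℝ) + 1) ≤ 1 / ((r : ℝ) + 1) := by gcongr
    linarith
  have hgapunion : P (⋃ r, gap r) = 1 := by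
    rw [← measure_univ (μ := P)]
    refine measure_congr (eventuallyEq_univ.2 ?_)
    filter_upwards [hmono] with ω hω
    have hex : ∀ k, ∃ r : ℕ, (p k ω).1 + 1 / ((r : ℝ) + 1) ≤ (p (k + 1) ω).1 := by
      intro k
      obtain ⟨r, hr⟩ := exists_nat_one_div_lt (sub_pos.2 (hω k.lt_succ_self))
      exact ⟨r, by linarith⟩
    choose r hr using hex
    refine mem_iUnion.2 ⟨(Finset.range (n + 1)).sup r, fun k hk => ?_⟩
    have hle : r k ≤ (Finset.range (n + 1)).sup r :=
      Finset.le_sup (Finset.mem_range.2 (Nat.lt_succ_of_le hk))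
    have : 1 / ((((Finset.range (n + 1)).sup r : ℕ) : ℝ) + 1) ≤ 1 / ((r k : ℝ) + 1) := by gcongr
    linarith [hr k]
  have hgaplim : Tendsto (fun r => P (gap r)) atTop (𝓝 1) :=
    hgapunion ▸ tendsto_measure_iUnion_atTop hgapmono
  -- The events `Z h B i` that the point of index `n` is alone in the `i`-th cell.
  have hZmeas : ∀ {h : ℝ} {B : ℕ → Set (ℝ × ℝ)}, (∀ k, MeasurableSet (B k)) → ∀ i,
      MeasurableSet (Z h B i) := fun hB i =>
    (measurableSet_gridEvent hN hB i n).inter (measurableSet_singlePoint hN (hB n) i)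
  have hZprob : ∀ {h : ℝ}, 0 < h → ∀ {B : ℕ → Set (ℝ × ℝ)}, (∀ k, MeasurableSet (B k)) → ∀ i,
      P (Z h B i) = (∏ k ∈ Finset.range (n + 1), markLaw ν (B k))
        * P (Z h (fun _ => univ) i) := by
    intro h hh B hB i
    simp only [hZ]
    rw [measure_gridEvent_inter_singlePoint hN hh hB,
      measure_gridEvent_inter_singlePoint hN hh (fun _ => MeasurableSet.univ),
      measure_gridEvent_eq hN hh hB, Finset.prod_range_succ, measure_univ]
    ring
  have hZdisj : ∀ {h : ℝ}, 0 < h → ∀ {B : ℕ → Set (ℝ × ℝ)}, (∀ k, MeasurableSet (B k)) →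
      Pairwise (Function.onFun (AEDisjoint P) (Z h B)) := by
    intro h hh B hB i j hij
    refine measure_eq_zero_iff_ae_notMem.2 ?_
    filter_upwards [hmono, ae_time_nonneg hN] with ω hω hpos hmem
    have hin : ∀ i, ω ∈ Z h B i → (p n ω).1 ∈ gridCell h i := by
      intro i hi
      obtain ⟨m, hm, -⟩ := (mem_singlePoint_iff (hB n) i).1 hi.2
      obtain rfl := eq_of_single_of_preceding hω hm (of_mem_gridEvent hh hB hω hpos i n hi.1).1
      exact (hm m).2 rfl
    exact disjoint_left.1 (disjoint_gridCell hh hij) (hin i hmem.1) (hin j hmem.2)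
  have hUnion : ∀ {h : ℝ}, 0 < h → ∀ {B : ℕ → Set (ℝ × ℝ)}, (∀ k, MeasurableSet (B k)) →
      P (⋃ i, Z h B i) = (∏ k ∈ Finset.range (n + 1), markLaw ν (B k))
        * ∑' i, P (Z h (fun _ => univ) i) := by
    intro h hh B hB
    rw [measure_iUnion₀ (hZdisj hh hB) fun i => (hZmeas hB i).nullMeasurableSet,
      ← ENNReal.tsum_mul_left]
    exact tsum_congr fun i => hZprob hh hB i
  have hsub : ∀ {h : ℝ}, 0 < h → ∀ {B : ℕ → Set (ℝ × ℝ)}, (∀ k, MeasurableSet (B k)) →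
      P (⋃ i, Z h B i) ≤ P {ω | ∀ k ≤ n, (p k ω).2 ∈ B k} := by
    intro h hh B hB
    refine measure_mono_ae ?_
    filter_upwards [hmono, ae_time_nonneg hN] with ω hω hpos hmem
    obtain ⟨i, hi⟩ := mem_iUnion.1 hmem
    obtain ⟨h1, h2⟩ := of_mem_gridEvent hh hB hω hpos i n hi.1
    obtain ⟨m, hm, hmB⟩ := (mem_singlePoint_iff (hB n) i).1 hi.2
    obtain rfl := eq_of_single_of_preceding hω hm h1
    intro k hk
    rcases hk.lt_or_eq with hk | rfl
    · exact h2 k hk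
    · exact hmB
  have hsup : ∀ (r : ℕ) {B : ℕ → Set (ℝ × ℝ)}, (∀ k, MeasurableSet (B k)) →
      P ({ω | ∀ k ≤ n, (p k ω).2 ∈ B k} ∩ gap r) ≤ P (⋃ i, Z (1 / ((r : ℝ) + 1)) B i) := by
    intro r B hB
    have hh : (0 : ℝ) < 1 / ((r : ℝ) + 1) := by positivity
    refine measure_mono_ae ?_
    filter_upwards [hmono, ae_time_nonneg hN] with ω hω hpos hmem
    set h := 1 / ((r : ℝ) + 1)
    have hcell : (p n ω).1 ∈ gridCell h ⌊(p n ω).1 / h⌋₊ := by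
      refine mem_gridCell.2 ⟨(le_div_iff₀ hh).1 (Nat.floor_le (div_nonneg (hpos n) hh.le)), ?_⟩
      refine (div_lt_iff₀ hh).1 ?_
      push_cast
      exact Nat.lt_floor_add_one _
    have hgap' : ∀ k < n, (p k ω).1 + h ≤ (p (k + 1) ω).1 := fun k hk => hmem.2 k hk.le
    refine mem_iUnion.2 ⟨⌊(p n ω).1 / h⌋₊, ?_, ?_⟩
    · exact mem_gridEvent_of_gap hh hB hω hpos _ n (preceding_iff_of_gap hω hcell hgap') hgap'
        fun k hk => hmem.1 k hk.le
    · exact mem_singlePoint_of_gap hω (hB n) hcell hmem.2 (hmem.1 n le_rfl)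
  have hUm : ∀ _k : ℕ, MeasurableSet (univ : Set (ℝ × ℝ)) := fun _ => MeasurableSet.univ
  have hs_le : ∀ r : ℕ, ∑' i, P (Z (1 / ((r : ℝ) + 1)) (fun _ => univ) i) ≤ 1 := by
    intro r
    have := hUnion (h := 1 / ((r : ℝ) + 1)) (by positivity) hUm
    simp only [measure_univ, Finset.prod_const_one, one_mul] at this
    exact this ▸ prob_le_one
  have hs_ge : ∀ r : ℕ, P (gap r) ≤ ∑' i, P (Z (1 / ((r : ℝ) + 1)) (fun _ => univ) i) := by
    intro r
    have h1 := hUnion (h := 1 / ((r : ℝ) + 1)) (by positivity) hUm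
    have h2 := hsup r hUm
    simp only [measure_univ, Finset.prod_const_one, one_mul] at h1
    have h3 : gap r ⊆ {ω | ∀ k ≤ n, (p k ω).2 ∈ (univ : Set (ℝ × ℝ))} ∩ gap r :=
      subset_inter (fun _ _ _ _ => mem_univ _) subset_rfl
    exact (measure_mono h3).trans (h2.trans_eq h1)
  refine le_antisymm ?_ ?_
  · have hlim : Tendsto (fun r => P ({ω | ∀ k ≤ n, (p k ω).2 ∈ B k} ∩ gap r)) atTop
        (𝓝 (P {ω | ∀ k ≤ n, (p k ω).2 ∈ B k})) := by
      have h1 := tendsto_measure_iUnion_atTop (μ := P)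
        (s := fun r => {ω | ∀ k ≤ n, (p k ω).2 ∈ B k} ∩ gap r)
        fun r s hrs => inter_subset_inter_right _ (hgapmono hrs)
      rw [← inter_iUnion] at h1
      have h2 : P ({ω | ∀ k ≤ n, (p k ω).2 ∈ B k} ∩ ⋃ r, gap r)
          = P {ω | ∀ k ≤ n, (p k ω).2 ∈ B k} := by
        refine measure_inter_conull' ?_
        have := (prob_compl_eq_zero_iff (MeasurableSet.iUnion hgapmeas)).2 hgapunion
        exact measure_mono_null (fun ω hω => hω.2) this
      rwa [h2] at h1
    refine le_of_tendsto' hlim fun r => (hsup r hB).trans ?_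
    rw [hUnion (by positivity) hB]
    exact mul_le_of_le_one_right' (hs_le r)
  · have hlim := ENNReal.Tendsto.const_mul (a := ∏ k ∈ Finset.range (n + 1), markLaw ν (B k))
      hgaplim (Or.inl one_ne_zero)
    rw [mul_one] at hlim
    refine le_of_tendsto' hlim fun r => ?_
    calc _ ≤ (∏ k ∈ Finset.range (n + 1), markLaw ν (B k))
          * ∑' i, P (Z (1 / ((r : ℝ) + 1)) (fun _ => univ) i) := by
          gcongr
          exact hs_ge r
      _ = P (⋃ i, Z (1 / ((r : ℝ) + 1)) B i) := (hUnion (by positivity) hB).symm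
      _ ≤ _ := hsub (by positivity) hB

theorem map_mark_eq (hp : ∀ n, Measurable (p n))
    (hmono : ∀ᵐ ω ∂P, StrictMono fun k => (p k ω).1)
    (hN : IsPoissonRandomMeasure
      (fun ω => Measure.sum fun n => Measure.dirac (p n ω)) (intensity ν) P) (n : ℕ) :
    P.map (fun ω => (p n ω).2) = markLaw ν := by
  classical
  ext S hS
  have h := measure_marks_eq hp hmono hN (B := fun k => if k = n then S else univ)
    (fun k => by split_ifs <;> simp [hS]) n
  rw [Measure.map_apply (hp n).snd hS]
  have hset : {ω | ∀ k ≤ n, (p k ω).2 ∈ if k = n then S else univ}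
      = (fun ω => (p n ω).2) ⁻¹' S := by
    ext ω
    constructor
    · intro H
      simpa using H n le_rfl
    · intro H k _
      split_ifs with hk
      · rw [hk]; exact H
      · trivial
  rw [← hset, h, Finset.prod_eq_single n]
  · simp
  · intro k _ hk
    simp [hk]
  · simp

theorem iIndepFun_mark (hp : ∀ n, Measurable (p n))
    (hmono : ∀ᵐ ω ∂P, StrictMono fun k => (p k ω).1)
    (hN : IsPoissonRandomMeasure
      (fun ω => Measure.sum fun n => Measure.dirac (p n ω)) (intensity ν) P) :
    iIndepFun (fun n ω => (p n ω).2) P := by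
  classical
  rw [iIndepFun_iff_measure_inter_preimage_eq_mul]
  intro S sets hsets
  have hB : ∀ k, MeasurableSet (if k ∈ S then sets k else univ) := by
    intro k
    split_ifs with hk
    · exact hsets k hk
    · exact MeasurableSet.univ
  have hbound : ∀ k ∈ S, k ≤ S.sup id := fun k hk => Finset.le_sup (f := id) hk
  have h := measure_marks_eq hp hmono hN hB (S.sup id)
  have hset : {ω | ∀ k ≤ S.sup id, (p k ω).2 ∈ if k ∈ S then sets k else univ}
      = ⋂ i ∈ S, (fun ω => (p i ω).2) ⁻¹' sets i := by
    ext ω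
    simp only [mem_iInter, mem_preimage]
    constructor
    · intro H k hk
      simpa [hk] using H k (hbound k hk)
    · intro H k _
      split_ifs with hk
      · exact H k hk
      · trivial
  rw [← hset, h]
  have hsub : S ⊆ Finset.range (S.sup id + 1) := fun k hk =>
    Finset.mem_range.2 (Nat.lt_succ_of_le (hbound k hk))
  rw [← Finset.prod_subset hsub]
  · refine Finset.prod_congr rfl fun k hk => ?_
    rw [if_pos hk, ← map_mark_eq hp hmono hN k, Measure.map_apply (hp k).snd (hsets k hk)]
  · intro k _ hk
    simp [hk]

end Marks

/-! ### Almost sure bounds for the largest interval -/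

/-- The Borel-Cantelli lemma for eventually exponentially small probabilities. -/
theorem ae_eventually_notMem_of_le_exp {Ω : Type*} [MeasurableSpace Ω] {P : Measure Ω}
    {s : ℕ → Set Ω} {C θ : ℝ} (hθ : 0 < θ)
    (h : ∀ᶠ m : ℕ in atTop, P (s m) ≤ ENNReal.ofReal (C * Real.exp (-(θ * m)))) :
    ∀ᵐ ω ∂P, ∀ᶠ m in atTop, ω ∉ s m := by
  obtain ⟨m₀, hm₀⟩ := eventually_atTop.1 h
  have hsum : Summable fun m : ℕ => C * Real.exp (-(θ * m)) := by
    refine Summable.mul_left C ?_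
    have := Real.summable_exp_nat_mul_iff.2 (neg_lt_zero.2 hθ)
    refine this.congr fun m => ?_
    ring_nf
  have hbound : ∑' m, P (if m₀ ≤ m then s m else ∅) ≠ ∞ := by
    refine ne_top_of_le_ne_top hsum.tsum_ofReal_ne_top (ENNReal.tsum_le_tsum fun m => ?_)
    split_ifs with hm
    · exact hm₀ m hm
    · simp
  filter_upwards [ae_eventually_notMem hbound] with ω hω
  filter_upwards [hω, eventually_ge_atTop m₀] with m hm hge
  rwa [if_pos hge] at hm

/-- A stretched exponential beats every exponential. -/
theorem exists_mul_exp_neg_exp_le {b c γ : ℝ} (hc : 0 < c) (hγ : 0 < γ) :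
    ∃ C : ℝ, ∀ m : ℕ, Real.exp (b * m) * Real.exp (-(c * Real.exp (γ * m)))
      ≤ C * Real.exp (-(1 * m)) := by
  obtain ⟨k, hk⟩ := exists_nat_gt ((b + 1) / γ)
  rw [div_lt_iff₀ hγ] at hk
  refine ⟨k.factorial / c ^ k, fun m => ?_⟩
  have hy : 0 < c * Real.exp (γ * m) := by positivity
  have h1 : (c * Real.exp (γ * m)) ^ k / k.factorial ≤ Real.exp (c * Real.exp (γ * m)) :=
    Real.pow_div_factorial_le_exp _ hy.le k
  have h2 : Real.exp (-(c * Real.exp (γ * m)))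
      ≤ k.factorial / c ^ k * Real.exp (-(k * (γ * m))) := by
    rw [Real.exp_neg, Real.exp_neg, Real.exp_nat_mul, ← div_eq_mul_inv, div_div, ← mul_pow,
      inv_le_comm₀ (by positivity) (by positivity), inv_div]
    exact h1
  calc _ ≤ Real.exp (b * m) * (k.factorial / c ^ k * Real.exp (-(k * (γ * m)))) := by gcongr
    _ = k.factorial / c ^ k * Real.exp (b * m - k * (γ * m)) := by
        rw [sub_eq_add_neg, Real.exp_add]
        ring
    _ ≤ k.factorial / c ^ k * Real.exp (-(1 * m)) := by
        have hm : (0 : ℝ) ≤ m := m.cast_nonneg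
        gcongr
        nlinarith

/-- If finitely many points precede `t`, then they are the points of index less than
`countBefore p t`. -/
theorem lt_iff_lt_countBefore {p : ℕ → ℝ × ℝ × ℝ} (hmono : StrictMono fun n => (p n).1) {t : ℝ}
    (hfin : {n : ℕ | (p n).1 < t}.Finite) (k : ℕ) : (p k).1 < t ↔ k < countBefore p t := by
  classical
  obtain ⟨b, hb⟩ := hfin.exists_notMem
  have hex : ∃ n, ¬ (p n).1 < t := ⟨b, hb⟩
  have hset : {n : ℕ | (p n).1 < t} = Iio (Nat.find hex) := by
    ext n
    constructor
    · intro hn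
      by_contra hcon
      exact Nat.find_spec hex ((hmono.monotone (not_lt.1 hcon)).trans_lt hn)
    · exact fun hn => not_not.1 (Nat.find_min hex hn)
  have hcard : countBefore p t = Nat.find hex := by
    rw [countBefore, hset, ← Finset.coe_Iio, ncard_coe_finset, Nat.card_Iio]
  rw [hcard]
  exact Set.ext_iff.1 hset k

section Trajectories

variable {Ω : Type*} [MeasurableSpace Ω] {P : Measure Ω} [IsProbabilityMeasure P]
  {p : ℕ → Ω → ℝ × ℝ × ℝ} {ν : Measure ℝ} [IsProbabilityMeasure ν]

theorem ae_mark_mem (hν : ν (Ioc 0 1)ᶜ = 0) (hp : ∀ n, Measurable (p n))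
    (hmono : ∀ᵐ ω ∂P, StrictMono fun k => (p k ω).1)
    (hN : IsPoissonRandomMeasure
      (fun ω => Measure.sum fun n => Measure.dirac (p n ω)) (intensity ν) P) :
    ∀ᵐ ω ∂P, ∀ n, (p n ω).2 ∈ markSet := by
  refine ae_all_iff.2 fun n => ?_
  have h := ae_mem_markSet hν
  rw [← map_mark_eq hp hmono hN n] at h
  exact ae_of_ae_map (hp n).snd.aemeasurable h

theorem measurableSet_Iio_prod_univ (t : ℝ) :
    MeasurableSet (Iio t ×ˢ (univ : Set (ℝ × ℝ))) := measurableSet_Iio.prod MeasurableSet.univ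

theorem ae_finite_before (hN : IsPoissonRandomMeasure
      (fun ω => Measure.sum fun n => Measure.dirac (p n ω)) (intensity ν) P) :
    ∀ᵐ ω ∂P, ∀ t : ℝ, {n : ℕ | (p n ω).1 < t}.Finite := by
  have h : ∀ m : ℕ, ∀ᵐ ω ∂P, {n : ℕ | (p n ω).1 < m}.Finite := by
    intro m
    have hμ : intensity ν (Iio (m : ℝ) ×ˢ univ) ≠ ∞ := by
      rw [intensity_Iio_prod ν m.cast_nonneg MeasurableSet.univ]
      exact ENNReal.mul_ne_top ENNReal.ofReal_ne_top (measure_ne_top _ _)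
    filter_upwards [hN.ae_ne_top (measurableSet_Iio_prod_univ m) hμ] with ω hω
    rw [sum_dirac_apply (fun n => p n ω) (measurableSet_Iio_prod_univ m), ENat.toENNReal_ne_top,
      encard_ne_top_iff] at hω
    simpa using hω
  filter_upwards [ae_all_iff.2 h] with ω hω t
  obtain ⟨m, hm⟩ := exists_nat_ge t
  exact (hω m).subset fun n (hn : (p n ω).1 < t) => hn.trans_le hm

theorem sum_dirac_Iio_eq_countBefore {p : ℕ → ℝ × ℝ × ℝ} {t : ℝ}
    (hfin : {n : ℕ | (p n).1 < t}.Finite) :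
    (Measure.sum fun n => Measure.dirac (p n)) (Iio t ×ˢ univ) = countBefore p t := by
  have hset : {n | p n ∈ Iio t ×ˢ (univ : Set (ℝ × ℝ))} = {n : ℕ | (p n).1 < t} := by
    ext n
    simp
  rw [sum_dirac_apply p (measurableSet_Iio_prod_univ t), hset, countBefore, ← hfin.cast_ncard_eq]
  simp

/-- Almost surely, more than `exp m / 8` points precede every large integer time `m`. -/
theorem ae_eventually_lt_countBefore (hN : IsPoissonRandomMeasure
      (fun ω => Measure.sum fun n => Measure.dirac (p n ω)) (intensity ν) P) :
    ∀ᵐ ω ∂P, ∀ᶠ m : ℕ in atTop,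
      ⌊Real.exp m / 8⌋₊ < countBefore (fun n => p n ω) m := by
  have hbc : ∀ᵐ ω ∂P, ∀ᶠ m : ℕ in atTop, ω ∉ {ω | (Measure.sum fun n => Measure.dirac (p n ω))
      (Iio (m : ℝ) ×ˢ univ) ∈ Iic ((⌊Real.exp m / 8⌋₊ : ℕ) : ℝ≥0∞)} := by
    refine ae_eventually_notMem_of_le_exp (C := Real.exp (1 / 2)) (θ := 3 / 8) (by norm_num)
      (Eventually.of_forall fun m => ?_)
    have hμ : intensity ν (Iio (m : ℝ) ×ˢ univ) = ENNReal.ofReal (Real.exp m - 1) := by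
      rw [intensity_Iio_prod ν m.cast_nonneg MeasurableSet.univ, measure_univ, mul_one]
    have h := hN.measure_preimage (measurableSet_Iio_prod_univ m)
      (by rw [hμ]; exact ENNReal.ofReal_ne_top)
      (measurableSet_Iic (a := ((⌊Real.exp m / 8⌋₊ : ℕ) : ℝ≥0∞)))
    have hpre : (fun k : ℕ => (k : ℝ≥0∞)) ⁻¹' Iic ((⌊Real.exp m / 8⌋₊ : ℕ) : ℝ≥0∞)
        = Iic ⌊Real.exp m / 8⌋₊ := by
      ext k
      simp
    rw [hpre] at h
    rw [h]
    refine (poissonMeasure_Iic_le _ _).trans (ENNReal.ofReal_le_ofReal ?_)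
    have hr : ((intensity ν (Iio (m : ℝ) ×ˢ univ)).toNNReal : ℝ) = Real.exp m - 1 := by
      rw [ENNReal.coe_toNNReal_eq_toReal, hμ, ENNReal.toReal_ofReal]
      linarith [Real.add_one_le_exp (m : ℝ), (m.cast_nonneg : (0 : ℝ) ≤ m)]
    rw [hr]
    have h2 : (2 : ℝ) ^ ⌊Real.exp m / 8⌋₊ ≤ Real.exp (Real.exp m / 8) := by
      calc (2 : ℝ) ^ ⌊Real.exp m / 8⌋₊ ≤ Real.exp 1 ^ ⌊Real.exp m / 8⌋₊ := by
            gcongr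
            linarith [Real.add_one_le_exp (1 : ℝ)]
        _ = Real.exp ⌊Real.exp m / 8⌋₊ := by rw [← Real.exp_nat_mul, mul_one]
        _ ≤ _ := Real.exp_le_exp.2 (Nat.floor_le (by positivity))
    calc _ ≤ Real.exp (Real.exp m / 8) * Real.exp (-(Real.exp m - 1) / 2) := by gcongr
      _ = Real.exp (1 / 2 - 3 / 8 * Real.exp m) := by
          rw [← Real.exp_add]
          ring_nf
      _ ≤ Real.exp (1 / 2) * Real.exp (-(3 / 8 * m)) := by
          rw [← Real.exp_add]
          refine Real.exp_le_exp.2 ?_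
          linarith [Real.add_one_le_exp (m : ℝ)]
  filter_upwards [hbc, ae_finite_before hN] with ω hω hfin
  filter_upwards [hω] with m hm
  have := sum_dirac_Iio_eq_countBefore (hfin m)
  simpa [this] using hm

/-- The intervals of length at least `exp (-β m)` have disappeared after `exp m / 8` splits. -/
theorem ae_eventually_lengthsAfter_lt (hν : ν (Ioc 0 1)ᶜ = 0) {κ c δ : ℝ} (hκ : 1 ≤ κ)
    (hc : 0 < c) (hδ : 0 < δ)
    (hψ : ∀ᵐ u ∂(volume : Measure ℝ), u ∈ Ioo (1 - δ) 1 →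
      ENNReal.ofReal (c * κ * (1 - u) ^ (κ - 1)) ≤ ν.rnDeriv volume u)
    {I₀ : Multiset ℝ} (hI₀ : IsConfig I₀) (hp : ∀ n, Measurable (p n))
    (hmono : ∀ᵐ ω ∂P, StrictMono fun k => (p k ω).1)
    (hN : IsPoissonRandomMeasure
      (fun ω => Measure.sum fun n => Measure.dirac (p n ω)) (intensity ν) P)
    {β : ℝ} (hβ : 0 < β) (hβκ : β < 1 / κ) :
    ∀ᵐ ω ∂P, ∀ᶠ m : ℕ in atTop,
      ∀ a ∈ lengthsAfter I₀ (fun n => p n ω) ⌊Real.exp m / 8⌋₊, a < Real.exp (-(β * m)) := by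
  set δ' := min δ (1 / 2) with hδ'
  have hδ'pos : 0 < δ' := lt_min hδ (by norm_num)
  have hψ' : ∀ᵐ u ∂(volume : Measure ℝ), u ∈ Ioo (1 - δ') 1 →
      ENNReal.ofReal (c * κ * (1 - u) ^ (κ - 1)) ≤ ν.rnDeriv volume u := by
    filter_upwards [hψ] with u hu hmem
    exact hu ⟨by linarith [min_le_left δ (1 / 2), hmem.1], hmem.2⟩
  set K := c * κ * δ' / 2 ^ κ with hK
  have hKpos : 0 < K := by positivity
  have hγ : 0 < 1 - β * κ := by
    rw [lt_div_iff₀ (by positivity)] at hβκ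
    linarith
  -- The rate `r` at which the energy above `exp (-β m)` decays.
  have hrate : ∀ m : ℕ, c * κ * δ' * (Real.exp (-(β * m)) / 2) ^ κ
      = K * Real.exp (-(β * κ * m)) := by
    intro m
    rw [Real.div_rpow (Real.exp_nonneg _) zero_le_two, ← Real.exp_mul, hK]
    ring_nf
  have hx_lim : Tendsto (fun m : ℕ => Real.exp (-(β * m))) atTop (𝓝 0) :=
    Real.tendsto_exp_neg_atTop_nhds_zero.comp
      (tendsto_natCast_atTop_atTop.const_mul_atTop hβ)
  have hr_lim : Tendsto (fun m : ℕ => K * Real.exp (-(β * κ * m))) atTop (𝓝 (K * 0)) :=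
    (Real.tendsto_exp_neg_atTop_nhds_zero.comp
      (tendsto_natCast_atTop_atTop.const_mul_atTop (by positivity))).const_mul K
  rw [mul_zero] at hr_lim
  have hexp_lim : Tendsto (fun m : ℕ => Real.exp m) atTop atTop :=
    Real.tendsto_exp_atTop.comp tendsto_natCast_atTop_atTop
  obtain ⟨C, hC⟩ := exists_mul_exp_neg_exp_le (b := 2 * β) (c := K / 48) (by positivity) hγ
  have hbc : ∀ᵐ ω ∂P, ∀ᶠ m : ℕ in atTop, ω ∉ {ω | ∃ a ∈ (Config.chain ⟨I₀, hI₀⟩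
      (fun k => (p k ω).2) ⌊Real.exp m / 8⌋₊).1, Real.exp (-(β * m)) ≤ a} := by
    refine ae_eventually_notMem_of_le_exp (C := C) one_pos ?_
    filter_upwards [hx_lim.eventually_le_const hδ'pos,
      hr_lim.eventually_le_const (show (0 : ℝ) < 3 by norm_num),
      hexp_lim.eventually_ge_atTop 16] with m hxm hrm hm
    refine (measure_exists_chain_ge_le (M := fun n ω => (p n ω).2) hν (fun n => (hp n).snd)
      (iIndepFun_mark hp hmono hN) (map_mark_eq hp hmono hN) (Real.exp_pos _) hrm (fun I => ?_)
      ⟨I₀, hI₀⟩ _).trans (ENNReal.ofReal_le_ofReal (le_trans ?_ (hC m)))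
    · rw [← hrate m]
      exact I.le_lintegral_sqAbove hκ hc (min_le_right _ _) hψ' (Real.exp_pos _) hxm
    · have hfloor : Real.exp m / 16 ≤ ⌊Real.exp m / 8⌋₊ := by
        linarith [Nat.lt_floor_add_one (Real.exp m / 8)]
      have h1 : (Real.exp (-(β * m)))⁻¹ ^ 2 = Real.exp (2 * β * m) := by
        rw [← Real.exp_neg, ← Real.exp_nat_mul]
        congr 1
        push_cast
        ring
      have h2 : Real.exp ((1 - β * κ) * m) = Real.exp (-(β * κ * m)) * Real.exp m := by
        rw [← Real.exp_add]
        ring_nf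
      have h3 : 0 ≤ K * Real.exp (-(β * κ * m)) := by positivity
      rw [h1, h2]
      refine mul_le_mul_of_nonneg_left (Real.exp_le_exp.2 ?_) (Real.exp_nonneg _)
      nlinarith
  filter_upwards [hbc, ae_mark_mem hν hp hmono hN] with ω hω hmark
  filter_upwards [hω] with m hm a ha
  by_contra! hcon
  refine hm ⟨a, ?_, hcon⟩
  rwa [Config.chain_eq_lengthsAfter _ hmark]

/-- The upper bound for the length of the largest interval. -/
theorem ae_eventually_largest_le (hν : ν (Ioc 0 1)ᶜ = 0) {κ c δ : ℝ} (hκ : 1 ≤ κ)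
    (hc : 0 < c) (hδ : 0 < δ)
    (hψ : ∀ᵐ u ∂(volume : Measure ℝ), u ∈ Ioo (1 - δ) 1 →
      ENNReal.ofReal (c * κ * (1 - u) ^ (κ - 1)) ≤ ν.rnDeriv volume u)
    {I₀ : Multiset ℝ} (hI₀ : IsConfig I₀) (hp : ∀ n, Measurable (p n))
    (hmono : ∀ᵐ ω ∂P, StrictMono fun k => (p k ω).1)
    (hN : IsPoissonRandomMeasure
      (fun ω => Measure.sum fun n => Measure.dirac (p n ω)) (intensity ν) P)
    {α : ℝ} (hα : α < 1 / κ) :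
    ∀ᵐ ω ∂P, ∃ T : ℝ, ∀ t ≥ T, largest I₀ (fun n => p n ω) t ≤ Real.exp (-α * t) := by
  obtain ⟨β, hβ1, hβκ⟩ := exists_between (max_lt hα (show 0 < 1 / κ by positivity))
  have hβ : 0 < β := (le_max_right α 0).trans_lt hβ1
  filter_upwards [ae_eventually_lengthsAfter_lt hν hκ hc hδ hψ hI₀ hp hmono hN hβ hβκ,
    ae_eventually_lt_countBefore hN, ae_mark_mem hν hp hmono hN, ae_finite_before hN]
    with ω hlt hcount hmark hfin
  obtain ⟨m₀, hm₀⟩ := eventually_atTop.1 (hlt.and hcount)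
  set A := max α 0 with hA
  refine ⟨max (m₀ + 1) (A / (β - A) + 1), fun t ht => ?_⟩
  have ht1 : (m₀ : ℝ) + 1 ≤ t := (le_max_left _ _).trans ht
  have ht2 : A / (β - A) + 1 ≤ t := (le_max_right _ _).trans ht
  have ht0 : 0 ≤ t := by linarith [(m₀.cast_nonneg : (0 : ℝ) ≤ m₀)]
  have hfl := Nat.floor_le ht0
  have hfl' := Nat.lt_floor_add_one t
  obtain ⟨h1, h2⟩ := hm₀ ⌊t⌋₊ (Nat.le_floor (by linarith))
  have hmon : countBefore (fun n => p n ω) ⌊t⌋₊ ≤ countBefore (fun n => p n ω) t :=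
    ncard_le_ncard (fun n (hn : (p n ω).1 < ⌊t⌋₊) => hn.trans_le hfl) (hfin t)
  have h3 := hI₀.forall_mem_lengthsAfter_le hmark (h2.le.trans hmon) fun a ha => (h1 a ha).le
  refine ((hI₀.lengthsAfter hmark _).sSup_quantile_le h3).trans (Real.exp_le_exp.2 ?_)
  have hA' : α * t ≤ A * t := mul_le_mul_of_nonneg_right (le_max_left _ _) ht0
  have hA0 : 0 ≤ A := le_max_right _ _
  have h4 : A ≤ ⌊t⌋₊ * (β - A) := by
    rw [← div_le_iff₀ (by linarith)]
    linarith
  nlinarith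

/-- The lower bound for the length of the largest interval: up to time `m` no mark falls into the
top stretch `(1 - 2 exp (-β m), 1]`, so that a length of at least `exp (-β m)` survives. -/
theorem ae_eventually_lt_largest (hν : ν (Ioc 0 1)ᶜ = 0) {κ C : ℝ} (hκ : 1 ≤ κ)
    (hC : ∀ᶠ u in 𝓝[<] (1 : ℝ), 1 - cdf ν u ≤ C * (1 - u) ^ κ)
    {I₀ : Multiset ℝ} (hI₀ : IsConfig I₀) (hp : ∀ n, Measurable (p n))
    (hmono : ∀ᵐ ω ∂P, StrictMono fun k => (p k ω).1)
    (hN : IsPoissonRandomMeasure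
      (fun ω => Measure.sum fun n => Measure.dirac (p n ω)) (intensity ν) P)
    {α : ℝ} (hα : 1 / κ < α) :
    ∀ᵐ ω ∂P, ∃ T : ℝ, ∀ t ≥ T, Real.exp (-α * t) < largest I₀ (fun n => p n ω) t := by
  obtain ⟨β, hβκ, hβα⟩ := exists_between hα
  have hκ0 : 0 < κ := by linarith
  have hβ : 0 < β := lt_trans (by positivity) hβκ
  have hγ : 0 < β * κ - 1 := by
    rw [div_lt_iff₀ hκ0] at hβκ
    linarith
  have hx_lim : Tendsto (fun m : ℕ => Real.exp (-(β * m))) atTop (𝓝 0) :=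
    Real.tendsto_exp_neg_atTop_nhds_zero.comp
      (tendsto_natCast_atTop_atTop.const_mul_atTop hβ)
  have hu_lim : Tendsto (fun m : ℕ => 1 - 2 * Real.exp (-(β * m))) atTop (𝓝[<] 1) := by
    refine tendsto_nhdsWithin_iff.2 ⟨?_, Eventually.of_forall fun m => ?_⟩
    · simpa using (hx_lim.const_mul 2).const_sub 1
    · simp only [mem_Iio]
      linarith [Real.exp_pos (-(β * m))]
  have hS : ∀ m : ℕ, MeasurableSet
      (Ioi (1 - 2 * Real.exp (-(β * m))) ×ˢ (univ : Set ℝ)) := fun m =>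
    measurableSet_Ioi.prod MeasurableSet.univ
  have hbc : ∀ᵐ ω ∂P, ∀ᶠ m : ℕ in atTop, ω ∉ {ω | (Measure.sum fun n => Measure.dirac (p n ω))
      (Iio (m : ℝ) ×ˢ (Ioi (1 - 2 * Real.exp (-(β * m))) ×ˢ univ)) ≠ 0} := by
    refine ae_eventually_notMem_of_le_exp (C := |C| * 2 ^ κ) hγ ?_
    filter_upwards [hu_lim.eventually hC] with m hm
    have hμ := intensity_Iio_prod ν m.cast_nonneg (hS m)
    have hν' : markLaw ν (Ioi (1 - 2 * Real.exp (-(β * m))) ×ˢ univ)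
        = ENNReal.ofReal (1 - cdf ν (1 - 2 * Real.exp (-(β * m)))) := by
      rw [markLaw, Measure.prod_prod, measure_univ, mul_one, cdf_eq_real,
        ← probReal_compl_eq_one_sub measurableSet_Iic, compl_Iic, ofReal_measureReal]
    refine (hN.measure_ne_zero_le (measurableSet_Iio.prod (hS m)) ?_).trans ?_
    · rw [hμ]
      exact ENNReal.mul_ne_top ENNReal.ofReal_ne_top (measure_ne_top _ _)
    · have hexp1 : 0 ≤ Real.exp m - 1 := by
        linarith [Real.add_one_le_exp (m : ℝ), (m.cast_nonneg : (0 : ℝ) ≤ m)]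
      rw [hμ, hν', ← ENNReal.ofReal_mul hexp1]
      refine ENNReal.ofReal_le_ofReal ?_
      have hpow : (1 - (1 - 2 * Real.exp (-(β * m)))) ^ κ
          = 2 ^ κ * Real.exp (-(β * κ * m)) := by
        rw [sub_sub_cancel, Real.mul_rpow zero_le_two (Real.exp_nonneg _), ← Real.exp_mul]
        ring_nf
      rw [hpow] at hm
      calc (Real.exp m - 1) * (1 - cdf ν (1 - 2 * Real.exp (-(β * m))))
          ≤ Real.exp m * (|C| * (2 ^ κ * Real.exp (-(β * κ * m)))) := by
            refine mul_le_mul (by linarith) (hm.trans ?_) (sub_nonneg.2 (cdf_le_one ν _))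
              (Real.exp_nonneg _)
            exact mul_le_mul_of_nonneg_right (le_abs_self C) (by positivity)
        _ = |C| * 2 ^ κ * Real.exp (-((β * κ - 1) * m)) := by
            rw [show -((β * κ - 1) * m) = m + -(β * κ * m) by ring, Real.exp_add]
            ring
  obtain ⟨M, hM, hMmax⟩ := hI₀.exists_max
  have hM0 : 0 < M := by
    by_contra! hcon
    have : I₀.sum = 0 := Multiset.sum_eq_zero fun a ha =>
      ((hMmax a ha).trans hcon).antisymm (hI₀.1 a ha)
    linarith [hI₀.2]
  filter_upwards [hbc, hmono, ae_mark_mem hν hp hmono hN, ae_finite_before hN]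
    with ω hω hmonoω hmark hfin
  obtain ⟨m₀, hm₀⟩ := eventually_atTop.1 (hω.and (hx_lim.eventually_le_const hM0))
  refine ⟨max m₀ (β / (α - β) + 1), fun t ht => ?_⟩
  have ht1 : (m₀ : ℝ) ≤ t := (le_max_left _ _).trans ht
  have ht2 : β / (α - β) + 1 ≤ t := (le_max_right _ _).trans ht
  have ht0 : 0 ≤ t := le_trans m₀.cast_nonneg ht1
  set m := ⌊t⌋₊ + 1 with hmdef
  have hmt : (m : ℝ) ≤ t + 1 := by
    rw [hmdef]
    push_cast
    linarith [Nat.floor_le ht0]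
  have htm : t < m := by
    rw [hmdef]
    push_cast
    exact Nat.lt_floor_add_one t
  obtain ⟨h1, h2⟩ := hm₀ m ((Nat.le_floor ht1).trans (Nat.le_succ _))
  have h1' := (sum_dirac_eq_zero_iff (fun n => p n ω) (measurableSet_Iio.prod (hS m))).1
    (not_not.1 h1)
  have hux : ∀ k < countBefore (fun n => p n ω) t,
      (p k ω).2.1 ≤ 1 - 2 * Real.exp (-(β * m)) := by
    intro k hk
    by_contra! hcon
    exact h1' k ⟨((lt_iff_lt_countBefore hmonoω (hfin t) k).2 hk).trans htm, hcon, mem_univ _⟩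
  obtain ⟨a, ha, hxa⟩ := hI₀.exists_mem_lengthsAfter_ge hmark hux ⟨M, hM, h2⟩
  have hlow := (hI₀.lengthsAfter hmark _).le_sSup_quantile ha
    ((Real.exp_pos _).trans_le hxa)
  refine lt_of_lt_of_le (Real.exp_lt_exp.2 ?_) (hxa.trans hlow)
  have h4 : β < t * (α - β) := by
    rw [← div_lt_iff₀ (by linarith)]
    linarith
  nlinarith

end Trajectories

end IntervalSplitting

end

theorem lemma5p2
    {Ω : Type*} [MeasurableSpace Ω] (P : Measure Ω) [IsProbabilityMeasure P]
    -- the law `ν` on `(0,1]` with distribution function `Ψ = cdf ν`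
    (ν : Measure ℝ) [IsProbabilityMeasure ν] (hν : ν (Ioc 0 1)ᶜ = 0)
    -- the density of the absolutely continuous part of `ν` is at least `c κ (1-u)^(κ-1)` near `1`
    (κ c δ : ℝ) (hκ : 1 ≤ κ) (hc : 0 < c) (hδ : 0 < δ)
    (hψ : ∀ᵐ u ∂(volume : Measure ℝ), u ∈ Ioo (1 - δ) 1 →
      ENNReal.ofReal (c * κ * (1 - u) ^ (κ - 1)) ≤ ν.rnDeriv volume u)
    -- the initial interval lengths
    (I₀ : Multiset ℝ) (hpos : ∀ a ∈ I₀, 0 < a) (hsum : I₀.sum = 1)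
    -- the Poisson random measure, its points `p 0, p 1, …` being listed in order of time
    (p : ℕ → Ω → ℝ × ℝ × ℝ) (hp : ∀ n, Measurable (p n))
    (hmono : ∀ᵐ ω ∂P, StrictMono (fun n => (p n ω).1))
    (hPoisson : IntervalSplitting.IsPoissonRandomMeasure
      (fun ω => Measure.sum (fun n => Measure.dirac (p n ω)))
      (IntervalSplitting.intensity ν) P) :
    (∀ α : ℝ, α < 1 / κ → ∀ᵐ ω ∂P, ∃ T : ℝ, ∀ t ≥ T,
      IntervalSplitting.largest I₀ (fun n => p n ω) t ≤ Real.exp (-α * t)) ∧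
    -- the exponent is optimal
    (∀ C : ℝ, (∀ᶠ u in 𝓝[<] (1 : ℝ), 1 - cdf ν u ≤ C * (1 - u) ^ κ) →
      ∀ α : ℝ, 1 / κ < α → ∀ᵐ ω ∂P, ∃ T : ℝ, ∀ t ≥ T,
        Real.exp (-α * t) < IntervalSplitting.largest I₀ (fun n => p n ω) t) := by
  have hI₀ : IntervalSplitting.IsConfig I₀ := ⟨fun a ha => (hpos a ha).le, hsum⟩
  exact ⟨fun α hα =>
      IntervalSplitting.ae_eventually_largest_le hν hκ hc hδ hψ hI₀ hp hmono hPoisson hα,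
    fun C hC α hα =>
      IntervalSplitting.ae_eventually_lt_largest hν hκ hC hI₀ hp hmono hPoisson hα⟩
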